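/- Consider the $M/GI/1/n$ queue ($n\ge 0$ waiting places besides the customer in service) with Poisson arrivals of rate $\lambda>0$ and independent identically distributed service times, independent of the arrivals, with distribution function $B$, $B(0)=0$. Let $L_n$ be the number of customers lost during a busy period. Let $\mu>0$ and $\varepsilon\in\mathbb R$. For probability distributions $P,Q$ on $[0,\infty)$ write $P\le_{\mathscr C_\lambda}Q$ if $\int_0^\infty e^{-\lambda x}x^iP(x)\,dx\ge\int_0^\infty e^{-\lambda x}x^iQ(x)\,dx$ for all $i=0,1,2,\dots$, where $P(x),Q(x)$ denote the distribution functions. Let $E_\mu(x)=1-e^{-\mu x}$. Assume: (A) with $p=\tfrac12$: $B(x)=\tfrac12F(x)+\tfrac12(1-e^{-\mu x})$ for $x\ge 0$, where $F$ is the distribution function of a nonnegative random variable $\zeta$ with expectation $1/\mu$, and $\sup_{x,y}|F_y(x)-F(x)|<\varepsilon$, where $F_y(x)=\Pr\{\zeta\le x+y\mid\zeta>y\}$ and the supremum is over $x\ge 0$ and all $y\ge 0$ with $\Pr\{\zeta>y\}>0$; (D) there is $y^0\ge 0$ with $\Pr\{\zeta>y^0\}>0$ such that $F_{y^0}\le_{\mathscr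 C_\lambda}F_y$ for all $y\ge 0$ with $\Pr\{\zeta>y\}>0$. Fix such a $y^0$. Put $\widehat F(\lambda)=\int_0^\infty e^{-\lambda x}\,dF(x)$ and $\widehat B(\lambda)=\tfrac12\widehat F(\lambda)+\tfrac12\,\frac{\mu}{\mu+\lambda}$. Then there is a probability law on $\{0,1,2,\dots\}$, not depending on $n$ or on the distribution $G$ below, whose generating function $g$ satisfies $$g(z)<\frac{\widehat B(\lambda)}{1-z+z\widehat B(\lambda)}+2\varepsilon\cdot\frac{1-z+2z\widehat B(\lambda)}{1-z+z\widehat B(\lambda)},\qquad 0\le z\le 1,$$ and, for all complex $z$ with $|z|\le 1$, $$\left|g(z)-\frac{\widehat B(\lambda)}{1-z+z\widehat B(\lambda)}\right|<2\varepsilon\cdot\frac{1-|z|+2|z|\widehat B(\lambda)}{1-|z|+|z|\widehat B(\lambda)},$$ such that for every $n\ge 0$ and every probability distribution $G$ on $[0,\infty)$ with $G\le_{\mathscr C_\lambda}F_{y^0}$ and $G\le_{\mathscr C_\lambda}E_\mu$, $$L_n\ \ge_{st}\ \sum_{i=1}^{Z_n}\varsigma_i .$$ Here $Z_n$ is the size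 of the $n$th generation of the Galton--Watson branching process with $Z_0=1$ and offspring generating function $g$, and $\varsigma_1,\varsigma_2,\dots$ are independent identically distributed, independent of the branching process, with $$\Pr\{\varsigma_i=m\}=\int_0^\infty e^{-\lambda x}\frac{(\lambda x)^m}{m!}\,dG(x),\qquad m=0,1,2,\dots$$ -/

import Mathlib

open MeasureTheory ProbabilityTheory
open scoped NNReal ENNReal

noncomputable section

namespace LossQueue

/-- The law of the residual `ζ - y` given `ζ > y`, where `ζ` has law `F`. Its distribution function
is `F_y(x) = Pr{ζ ≤ x + y | ζ > y}`. It is used only for `y` with `Pr{ζ > y} > 0`. -/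
def residualLaw (F : Measure ℝ) (y : ℝ) : Measure ℝ :=
  (ProbabilityTheory.cond F (Set.Ioi y)).map (fun t => t - y)

/-- Condition (A): `B(0) = 0`, `B(x) = p F(x) + (1 - p) (1 - exp (-μ x))` with `0 < p ≤ 1`, where
`F` is the law of a nonnegative random variable with expectation `1 / μ`, and
`sup |F_y(x) - F(x)| < ε` over `x ≥ 0` and those `y ≥ 0` for which `F_y` is defined. -/
structure ConditionA (p μ ε : ℝ) (B F : Measure ℝ) : Prop where
  p_pos : 0 < p
  p_le_one : p ≤ 1
  service_pos : B (Set.Iic 0) = 0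
  mixture : ∀ x : ℝ, 0 ≤ x →
    cdf B x = p * cdf F x + (1 - p) * (1 - Real.exp (-(μ * x)))
  nonneg : F (Set.Iio 0) = 0
  integrable : Integrable (fun x : ℝ => x) F
  mean : ∫ x, x ∂F = 1 / μ
  close : sSup {d : ℝ | ∃ x y : ℝ, 0 ≤ x ∧ 0 ≤ y ∧ F (Set.Ioi y) ≠ 0 ∧
    d = |cdf (residualLaw F y) x - cdf F x|} < ε

/-- The order relation `P ≤ Q` in the sense of `𝒞_lam`, for laws on `[0, ∞)`. -/
def CLe (lam : ℝ) (P Q : Measure ℝ) : Prop :=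
  ∀ i : ℕ, ∫ x in Set.Ioi (0 : ℝ), Real.exp (-(lam * x)) * x ^ i * cdf Q x ≤
    ∫ x in Set.Ioi (0 : ℝ), Real.exp (-(lam * x)) * x ^ i * cdf P x

/-- Condition (D), with the index `y₀` of the least element displayed: `F_{y₀}` belongs to the
family of the `F_y` and `F_{y₀} ≤ F_y` in the order `𝒞_lam` for every member `F_y`. -/
structure ConditionD (lam : ℝ) (F : Measure ℝ) (y₀ : ℝ) : Prop where
  nonneg : 0 ≤ y₀
  defined : F (Set.Ioi y₀) ≠ 0
  least : ∀ y : ℝ, 0 ≤ y → F (Set.Ioi y) ≠ 0 →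
    CLe lam (residualLaw F y₀) (residualLaw F y)

/-- The transform `∫_0^∞ exp (-lam x) dF(x)`. -/
def laplace (F : Measure ℝ) (lam : ℝ) : ℝ :=
  ∫ x in Set.Ici (0 : ℝ), Real.exp (-(lam * x)) ∂F

/-- `p F̂(lam) + (1 - p) μ / (μ + lam)`. -/
def serviceTransform (p μ lam : ℝ) (F : Measure ℝ) : ℝ :=
  p * laplace F lam + (1 - p) * (μ / (μ + lam))

/-- `∫_0^∞ exp (-lam x) (lam x)^m / m! dG(x)`. -/
def mixedPoisson (lam : ℝ) (G : Measure ℝ) (m : ℕ) : ℝ :=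
  ∫ x in Set.Ici (0 : ℝ), Real.exp (-(lam * x)) * (lam * x) ^ m / (m.factorial : ℝ) ∂G

/-- The generating function `∑ q(m) z^m` of a law on `ℕ`, for real or complex `z`. -/
def pgf {𝕜 : Type*} [RCLike 𝕜] (q : PMF ℕ) (z : 𝕜) : 𝕜 :=
  ∑' m : ℕ, (((q m).toReal : ℝ) : 𝕜) * z ^ m

section Queue

variable {Ω : Type*} [MeasurableSpace Ω]

/-- `N` is (the counting process of) a Poisson process with rate `lam`. -/
structure IsPoissonProcess (lam : ℝ) (N : ℝ≥0 → Ω → ℕ) (P : Measure Ω) : Prop where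
  measurable : ∀ t, Measurable (N t)
  zero : ∀ ω, N 0 ω = 0
  mono : ∀ ω, Monotone (fun t => N t ω)
  right_continuous : ∀ ω t, ContinuousWithinAt (fun s => N s ω) (Set.Ici t) t
  indep_increments : HasIndepIncrements N P
  law_increment : ∀ s t : ℝ≥0, s ≤ t →
    HasLaw (fun ω => N t ω - N s ω) (poissonMeasure (lam.toNNReal * (t - s))) P

/-- The input of a busy period of the `M/GI/1` queue, started by an arrival into the empty system
at time `0`: `N t` customers arrive in `(0, t]`, and `χ k` is the duration of the `(k + 1)`-st
service of the busy period. -/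
structure IsQueueInput (lam : ℝ) (B : Measure ℝ) (N : ℝ≥0 → Ω → ℕ) (χ : ℕ → Ω → ℝ)
    (P : Measure Ω) : Prop where
  arrivals : IsPoissonProcess lam N P
  measurable_service : ∀ k, Measurable (χ k)
  law_service : ∀ k, HasLaw (χ k) B P
  indep_service : iIndepFun χ P
  indep : IndepFun (fun ω => fun t : ℝ≥0 => N t ω) (fun ω => fun k : ℕ => χ k ω) P

/-- The end of the `k`-th service: during a busy period the server is never idle. -/
def serviceEnd (χ : ℕ → Ω → ℝ) (k : ℕ) (ω : Ω) : ℝ≥0 :=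
  (∑ i ∈ Finset.range k, χ i ω).toNNReal

/-- The number of customers arriving during the `(k + 1)`-st service. -/
def arrivalsDuring (N : ℝ≥0 → Ω → ℕ) (χ : ℕ → Ω → ℝ) (ω : Ω) (k : ℕ) : ℕ :=
  N (serviceEnd χ (k + 1) ω) ω - N (serviceEnd χ k ω) ω

/-- The number of customers in the system immediately after the `k`-th service completion (for
`k = 0`: after the arrival that starts the busy period), when `a k` customers arrive during the
`(k + 1)`-st service. There is room for `n` waiting customers and one in service, so at most
`n + 1` customers are in the system. The value stays `0` after the end of the busy period. -/
def inSystem (n : ℕ) (a : ℕ → ℕ) : ℕ → ℕ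
  | 0 => 1
  | k + 1 => if inSystem n a k = 0 then 0 else min (inSystem n a k + a k) (n + 1) - 1

/-- The number `L_n` of losses during a busy period: within a service that starts with
`j ≥ 1` customers in the system and sees `a` arrivals, the arrivals after the first `n + 1 - j`
find a full system and are lost. -/
def losses (n : ℕ) (N : ℝ≥0 → Ω → ℕ) (χ : ℕ → Ω → ℝ) (ω : Ω) : ℕ∞ :=
  ∑' k : ℕ, if inSystem n (arrivalsDuring N χ ω) k = 0 then (0 : ℕ∞)
    else ((inSystem n (arrivalsDuring N χ ω) k + arrivalsDuring N χ ω k - (n + 1) : ℕ) : ℕ∞)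

/-- The size of the `k`-th generation of the Galton--Watson process with one ancestor in which the
`i`-th individual of generation `k` has `X k i` children. -/
def generationSize (X : ℕ → ℕ → Ω → ℕ) : ℕ → Ω → ℕ
  | 0, _ => 1
  | k + 1, ω => ∑ i ∈ Finset.range (generationSize X k ω), X k i ω

/-- The offspring numbers `X k i` have law `q`, the `ς i` have the law
`Pr{ς = m} = ∫_0^∞ exp (-lam x) (lam x)^m / m! dG(x)`, and all these variables are independent. -/
structure IsBranchingInput (q : PMF ℕ) (lam : ℝ) (G : Measure ℝ)
    (X : ℕ → ℕ → Ω → ℕ) (ς : ℕ → Ω → ℕ) (P : Measure Ω) : Prop where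
  measurable_offspring : ∀ k i, Measurable (X k i)
  law_offspring : ∀ k i, HasLaw (X k i) q.toMeasure P
  measurable_summand : ∀ i, Measurable (ς i)
  law_summand : ∀ i m, P.real {ω | ς i ω = m} = mixedPoisson lam G m
  indep : iIndepFun
    (fun c : (ℕ × ℕ) ⊕ ℕ => Sum.elim (fun a : ℕ × ℕ => X a.1 a.2) (fun i => ς i) c) P

end Queue

/-- The usual stochastic order `X ≤_st Y` between `ℕ∞`-valued variables, which may live on
different probability spaces. -/
def StochLE {Ω Ω' : Type*} [MeasurableSpace Ω] [MeasurableSpace Ω']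
    (X : Ω → ℕ∞) (P : Measure Ω) (Y : Ω' → ℕ∞) (Q : Measure Ω') : Prop :=
  ∀ m : ℕ∞, P {ω | m ≤ X ω} ≤ Q {ω | m ≤ Y ω}

end LossQueue

end

namespace LossQueue

/-! A nonnegative integer variable `ξ` is represented by the operator `f ↦ (x ↦ E f(x + ξ))`. Sums
of independent variables become compositions, random sums become `mix`, and stochastic domination
becomes an inequality on monotone `f`. The accumulated losses are the argument `x`.

Consider a service that starts with `j + 1` customers, so that `c = n - j` places are free, and the
losses until a service ends with `j` customers left. With probability `b = B̂(lam)` nobody arrives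
during this service and the level drops at once. Otherwise the first arrival takes a place, leaving
`c - 1` free ones, and the service goes on. Once the level is back at `j + 1`, a fresh service
starts and the situation repeats. Hence a geometric number of excursions, each with one place less:
this is `levelOp`. An excursion begins in the middle of a service, whose residual law depends on the
past. Condition (D) gives a uniform bound: given any number of arrivals so far in this service, a
further one comes with probability at least `r'`, the smaller of the values for the residual law
`F_{y₀}` and for the exponential law. After it there is again an excursion with one place less,
followed by a fresh service at the original level. So an excursion has offspring `0` with weight `1
- r'` and `1 + geometric` with weight `r'`. This is the offspring law `q`, which involves neither
`n` nor `G`. When no place is free, all further arrivals of the service are lost, and their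
conditional law dominates that of `ς`, the mixed Poisson law of `G`.

Composing over the levels gives `stateOp`, a subsolution of the one-step equations of the chain
(customers present, losses so far): `ResidualBound.genOp_le` and `ResidualBound.stateOp_le`. Its
expectation along the chain is therefore nondecreasing. The busy period ends almost surely, so the
initial value `levelOp n` bounds the tail of the losses from below (`levelOp_le_measure_losses`).
Finally `genOp n`, the operator of the branching sum, is below `levelOp n` because `r' ≤ 1 - b`.

The conditional bounds come from one identity: at least `i + 1` Poisson points fall in a service
exactly when an Erlang time is shorter than the service (`tsum_mixedPoisson`). Erlang times add, so
conditioning on earlier arrivals mixes residual laws over ages, and (D) applies age by age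
(`ConditionA.mul_tail_le`).

For the generating function, `g(z) - β / (1 - z + zβ)` equals `(q 0 - β)(1 - z) / (1 - z + zβ)`, so
only `|q 0 - β| < 2 ε` is needed. Integrating the residual laws of `F` over the age with weight `1 -
F` shows that the transforms of `F` and of the exponential law differ by less than `ε`. -/

/-! ### Averaging operators and random sums -/

/-- An operator on functions on `ℕ` that behaves like `f ↦ (x ↦ E f(x + ξ))` for a random
variable `ξ` with values in `ℕ`. -/
structure IsAveraging (T : (ℕ → ℝ≥0∞) → ℕ → ℝ≥0∞) : Prop where
  tsum : ∀ (g : ℕ → ℕ → ℝ≥0∞) (x : ℕ), T (fun y => ∑' k, g k y) x = ∑' k, T (g k) x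
  smul : ∀ (c : ℝ≥0∞) (f : ℕ → ℝ≥0∞) (x : ℕ), T (fun y => c * f y) x = c * T f x
  mono : ∀ {f g : ℕ → ℝ≥0∞}, (∀ x, f x ≤ g x) → ∀ x, T f x ≤ T g x
  monotone : ∀ {f : ℕ → ℝ≥0∞}, Monotone f → Monotone (T f)
  le_apply : ∀ {f : ℕ → ℝ≥0∞}, Monotone f → ∀ x, f x ≤ T f x
  apply_le_one : ∀ {f : ℕ → ℝ≥0∞}, (∀ x, f x ≤ 1) → ∀ x, T f x ≤ 1

/-- The averaging operator of a sum of `κ` independent copies, `κ` having the weights `w`. -/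
noncomputable def mix (w : ℕ → ℝ≥0∞) (T : (ℕ → ℝ≥0∞) → ℕ → ℝ≥0∞) (f : ℕ → ℝ≥0∞) (x : ℕ) : ℝ≥0∞ :=
  ∑' k, w k * T^[k] f x

/-- The shift `f ↦ f(· + 1)`. -/
def shift (f : ℕ → ℝ≥0∞) (x : ℕ) : ℝ≥0∞ := f (x + 1)

lemma shift_iterate (k : ℕ) (f : ℕ → ℝ≥0∞) (x : ℕ) : shift^[k] f x = f (x + k) := by
  induction k generalizing x with
  | zero => rfl
  | succ k ih =>
    rw [Function.iterate_succ_apply']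
    change shift^[k] f (x + 1) = _
    rw [ih]; congr 1; ring

lemma IsAveraging.iterate {T : (ℕ → ℝ≥0∞) → ℕ → ℝ≥0∞} (hT : IsAveraging T) (k : ℕ) :
    IsAveraging T^[k] := by
  induction k with
  | zero => exact ⟨fun _ _ => rfl, fun _ _ _ => rfl, fun h => h, fun h => h, fun _ _ => le_rfl,
      fun h => h⟩
  | succ k ih =>
    simp only [Function.iterate_succ']
    refine ⟨fun g x => ?_, fun c f x => ?_, fun h => hT.mono (ih.mono h),
      fun h => hT.monotone (ih.monotone h),
      fun h x => (ih.le_apply h x).trans (hT.le_apply (ih.monotone h) x),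
      fun h => hT.apply_le_one (ih.apply_le_one h)⟩
    · simp only [Function.comp_apply]
      rw [← hT.tsum]
      exact congrArg (fun u => T u x) (funext fun y => ih.tsum g y)
    · simp only [Function.comp_apply]
      rw [← hT.smul]
      exact congrArg (fun u => T u x) (funext fun y => ih.smul c f y)

lemma isAveraging_shift : IsAveraging shift :=
  ⟨fun _ _ => rfl, fun _ _ _ => rfl, fun h x => h (x + 1), fun h _ _ hxy => h (by omega),
    fun h _ => h (by omega), fun h x => h (x + 1)⟩

lemma IsAveraging.mix {T : (ℕ → ℝ≥0∞) → ℕ → ℝ≥0∞} (hT : IsAveraging T) {w : ℕ → ℝ≥0∞}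
    (hw : ∑' k, w k = 1) : IsAveraging (mix w T) where
  tsum g x := by
    simp only [LossQueue.mix, (hT.iterate _).tsum, ← ENNReal.tsum_mul_left]
    exact ENNReal.tsum_comm
  smul c f x := by
    simp only [LossQueue.mix, (hT.iterate _).smul, ← ENNReal.tsum_mul_left]
    exact tsum_congr fun k => by ring
  mono h x := ENNReal.tsum_le_tsum fun k => mul_le_mul_right ((hT.iterate k).mono h x) _
  monotone h _ _ hxy :=
    ENNReal.tsum_le_tsum fun k => mul_le_mul_right ((hT.iterate k).monotone h hxy) _
  le_apply {f} h x := by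
    calc f x = ∑' k, w k * f x := by rw [ENNReal.tsum_mul_right, hw, one_mul]
      _ ≤ _ := ENNReal.tsum_le_tsum fun k => mul_le_mul_right ((hT.iterate k).le_apply h x) _
  apply_le_one h x := by
    calc _ ≤ ∑' k, w k * 1 :=
          ENNReal.tsum_le_tsum fun k => mul_le_mul_right ((hT.iterate k).apply_le_one h x) _
      _ = 1 := by simp [hw]

/-- First-step decomposition of a mixture whose weights are proportional to `g` off `0`. -/
lemma IsAveraging.mix_eq {T : (ℕ → ℝ≥0∞) → ℕ → ℝ≥0∞} (hT : IsAveraging T) {w g : ℕ → ℝ≥0∞}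
    {c : ℝ≥0∞} (h : ∀ k, w (k + 1) = c * g k) (f : ℕ → ℝ≥0∞) (x : ℕ) :
    LossQueue.mix w T f x = w 0 * f x + c * T (LossQueue.mix g T f) x := by
  have h1 : T (LossQueue.mix g T f) x = ∑' k, g k * T^[k + 1] f x := by
    unfold LossQueue.mix
    rw [hT.tsum]
    refine tsum_congr fun k => ?_
    rw [hT.smul, Function.iterate_succ_apply']
  rw [h1, LossQueue.mix, tsum_eq_zero_add' ENNReal.summable, ← ENNReal.tsum_mul_left]
  simp only [Function.iterate_zero, id_eq, h, mul_assoc]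

/-! ### Operators of the branching process and of the queue -/

/-- The averaging operator of `∑_{i ≤ Z_c} ς_i`, when `ς` has the weights `s` and the offspring
numbers have the weights `w`. -/
noncomputable def genOp (s w : ℕ → ℝ≥0∞) : ℕ → (ℕ → ℝ≥0∞) → ℕ → ℝ≥0∞
  | 0 => mix s shift
  | c + 1 => mix w (genOp s w c)

/-- The operator which replaces the last offspring weights in `genOp` by the weights `g`. -/
noncomputable def levelOp (s w g : ℕ → ℝ≥0∞) : ℕ → (ℕ → ℝ≥0∞) → ℕ → ℝ≥0∞
  | 0 => genOp s w 0
  | c + 1 => mix g (genOp s w c)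

/-- The operator which bounds the number of losses until the end of the busy period when a service
starts with `j` customers in the system. -/
noncomputable def stateOp (s w g : ℕ → ℝ≥0∞) (n : ℕ) :
    ℕ → (ℕ → ℝ≥0∞) → ℕ → ℝ≥0∞
  | 0, f => f
  | j + 1, f => levelOp s w g (n - j) (stateOp s w g n j f)

/-- `w` is a mixture of the unit mass at `0` and the law of `1 + ξ`, where `ξ` has the geometric
weights `g`; the unit mass has weight `r = 1 - r'` in `w`, and `b = 1 - b'` is the weight
of `0` in `g`. -/
structure OffspringWeights (s w g : ℕ → ℝ≥0∞) (r r' b b' : ℝ≥0∞) : Prop where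
  summand : ∑' k, s k = 1
  offspring : ∑' k, w k = 1
  geom : ∑' k, g k = 1
  offspring_zero : w 0 = r
  offspring_succ : ∀ k, w (k + 1) = r' * g k
  geom_zero : g 0 = b
  geom_succ : ∀ k, g (k + 1) = b' * g k
  add_eq_one : r + r' = 1
  geom_add_eq_one : b + b' = 1

section Operators

variable {s w g : ℕ → ℝ≥0∞} {r r' b b' : ℝ≥0∞}

lemma OffspringWeights.genOp (h : OffspringWeights s w g r r' b b') (c : ℕ) :
    IsAveraging (genOp s w c) := by
  induction c with
  | zero => exact isAveraging_shift.mix h.summand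
  | succ c ih => exact ih.mix h.offspring

lemma OffspringWeights.levelOp (h : OffspringWeights s w g r r' b b') (c : ℕ) :
    IsAveraging (levelOp s w g c) := by
  cases c with
  | zero => exact h.genOp 0
  | succ c => exact (h.genOp c).mix h.geom

lemma OffspringWeights.stateOp (h : OffspringWeights s w g r r' b b') (n j : ℕ) :
    IsAveraging (stateOp s w g n j) := by
  induction j with
  | zero => exact isAveraging_shift.iterate 0
  | succ j ih =>
    have h1 := h.levelOp (n - j)
    refine ⟨fun u x => ?_, fun c f x => ?_, fun h => h1.mono (ih.mono h),
      fun h => h1.monotone (ih.monotone h),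
      fun h x => (ih.le_apply h x).trans (h1.le_apply (ih.monotone h) x),
      fun h => h1.apply_le_one (ih.apply_le_one h)⟩
    · simp only [LossQueue.stateOp]
      rw [← h1.tsum]
      exact congrArg (fun u => LossQueue.levelOp s w g (n - j) u x) (funext fun y => ih.tsum u y)
    · simp only [LossQueue.stateOp]
      rw [← h1.smul]
      exact congrArg (fun u => LossQueue.levelOp s w g (n - j) u x) (funext fun y => ih.smul c f y)

/-- A nonzero offspring number is `1 + geometric`: the first child contributes `genOp c`, and the
geometric number of its siblings contributes `levelOp (c + 1)`. -/
lemma OffspringWeights.genOp_succ (h : OffspringWeights s w g r r' b b') (c : ℕ)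
    (f : ℕ → ℝ≥0∞) (x : ℕ) :
    LossQueue.genOp s w (c + 1) f x
      = r * f x + r' * LossQueue.genOp s w c (LossQueue.levelOp s w g (c + 1) f) x := by
  rw [← h.offspring_zero]
  exact (h.genOp c).mix_eq h.offspring_succ f x

/-- Lack of memory of the geometric law: after a first copy of `genOp c` the number of remaining
copies is geometric again. -/
lemma OffspringWeights.levelOp_succ (h : OffspringWeights s w g r r' b b') (c : ℕ)
    (f : ℕ → ℝ≥0∞) (x : ℕ) :
    LossQueue.levelOp s w g (c + 1) f x
      = b * f x + b' * LossQueue.genOp s w c (LossQueue.levelOp s w g (c + 1) f) x := by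
  conv_rhs => rw [← h.geom_zero]
  exact (h.genOp c).mix_eq h.geom_succ f x

/-! ### The subsolution inequalities -/

/-- A convex combination of `u ≤ v` decreases with the weight of `u`. -/
lemma mul_add_mul_le_of_weight_le {r r' t t' p u v : ℝ≥0∞} (hr : r + r' = 1) (ht : t = p + t')
    (h1 : t ≤ 1) (h : r' * t ≤ t') (huv : u ≤ v) : t * (r * u + r' * v) ≤ p * u + t' * v := by
  obtain ⟨d, rfl⟩ := exists_add_of_le h
  have hr' : r' ≤ 1 := hr ▸ le_add_self
  have hfin : r' * t ≠ ⊤ :=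
    ENNReal.mul_ne_top (ne_top_of_le_ne_top ENNReal.one_ne_top hr')
      (ne_top_of_le_ne_top ENNReal.one_ne_top h1)
  have key : r * t = p + d := by
    have : r * t + r' * t = p + d + r' * t := by
      rw [← add_mul, hr, one_mul]
      conv_lhs => rw [ht]
      ring
    exact (ENNReal.add_left_inj hfin).1 this
  calc t * (r * u + r' * v) = (r * t) * u + r' * t * v := by ring
    _ = p * u + d * u + r' * t * v := by rw [key]; ring
    _ ≤ p * u + d * v + r' * t * v := by gcongr
    _ = _ := by ring

lemma tail_eq_add (p : ℕ → ℝ≥0∞) (m : ℕ) :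
    ∑' k, p (m + k) = p m + ∑' k, p (m + 1 + k) := by
  rw [tsum_eq_zero_add' ENNReal.summable]
  congr 1
  exact tsum_congr fun k => by congr 1; ring

/-- Domination of tails implies domination of the integrals of nondecreasing functions. -/
lemma tsum_mul_le_of_tail_le {p p' : ℕ → ℝ≥0∞} (h : ∀ i, ∑' k, p (i + k) ≤ ∑' k, p' (i + k))
    {f : ℕ → ℝ≥0∞} (hf : Monotone f) : ∑' k, p k * f k ≤ ∑' k, p' k * f k := by
  obtain ⟨d, hd⟩ : ∃ d : ℕ → ℝ≥0∞, ∀ k, f k = ∑' i, if i ≤ k then d i else 0 := by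
    -- Summation by parts: with the increments of `f` as weights, the integral of `f` is a
    -- nonnegative combination of tails.
    refine ⟨fun i => if i = 0 then f 0 else f i - f (i - 1), fun k => ?_⟩
    rw [tsum_eq_sum (s := Finset.range (k + 1))
      (fun i hi => if_neg (by simpa using hi))]
    rw [Finset.sum_congr rfl (fun i hi => if_pos (by simp at hi; omega))]
    induction k with
    | zero => simp
    | succ k ih =>
      rw [Finset.sum_range_succ, ← ih]
      simp only [Nat.add_eq_zero_iff, one_ne_zero, and_false, if_false, add_tsub_cancel_right]
      exact (add_tsub_cancel_of_le (hf (Nat.le_succ k))).symm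
  have key : ∀ p : ℕ → ℝ≥0∞, ∑' k, p k * f k = ∑' i, d i * ∑' k, p (i + k) := by
    intro p
    simp only [hd, ← ENNReal.tsum_mul_left]
    rw [ENNReal.tsum_comm]
    refine tsum_congr fun i => ?_
    rw [← Summable.sum_add_tsum_nat_add' (k := i) ENNReal.summable, Finset.sum_eq_zero, zero_add]
    · exact tsum_congr fun k => by rw [if_pos (by omega), mul_comm, add_comm]
    · intro k hk
      rw [if_neg (by simpa using hk), mul_zero]
  rw [key, key]
  exact ENNReal.tsum_le_tsum fun i => mul_le_mul_right (h i) _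

/-- The residual numbers of arrivals dominate the summands, and vanish with probability at
most `1 - r'`. -/
structure ResidualBound (p s : ℕ → ℝ≥0∞) (r' : ℝ≥0∞) : Prop where
  tsum_eq_one : ∑' k, p k = 1
  succ : ∀ m, r' * ∑' k, p (m + k) ≤ ∑' k, p (m + 1 + k)
  add : ∀ m i, (∑' k, p (m + k)) * ∑' k, s (i + k) ≤ ∑' k, p (m + i + k)

variable {p : ℕ → ℝ≥0∞}

lemma ResidualBound.tail_le_one (hp : ResidualBound p s r') (m : ℕ) : ∑' k, p (m + k) ≤ 1 := by
  rw [← hp.tsum_eq_one]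
  exact ENNReal.tsum_comp_le_tsum_of_injective (add_right_injective m) p

/-- One service with residual number of arrivals `a - m`, given `a ≥ m`, started with `j + 1`
customers in the system. -/
lemma ResidualBound.genOp_le (h : OffspringWeights s w g r r' b b') (hp : ResidualBound p s r')
    {n : ℕ} {f : ℕ → ℝ≥0∞} (hf : Monotone f) (c j m : ℕ) (hc : j + c = n) (x : ℕ) :
    (∑' k, p (m + k)) * genOp s w c (stateOp s w g n j f) x ≤
      ∑' a, p (m + a) * stateOp s w g n (min (j + 1 + a) (n + 1) - 1) f
        (x + (j + 1 + a - (n + 1))) := by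
  induction c generalizing j m with
  | zero =>
    obtain rfl : j = n := by omega
    -- The system is full: each of the `a` further arrivals is lost, and the service ends with `j`
    -- customers.
    have h1 : ∀ a, stateOp s w g j (min (j + 1 + a) (j + 1) - 1) f (x + (j + 1 + a - (j + 1)))
        = stateOp s w g j j f (x + a) := fun a => by
      rw [min_eq_right (by omega)]
      simp
    simp only [h1]
    simp only [genOp, mix, shift_iterate, ← ENNReal.tsum_mul_left, ← mul_assoc]
    refine tsum_mul_le_of_tail_le (p := fun k => (∑' k, p (m + k)) * s k)
      (p' := fun k => p (m + k)) (fun i => ?_) fun _ _ hxy =>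
      (h.stateOp j j).monotone hf (by omega)
    rw [ENNReal.tsum_mul_left]
    simpa only [add_assoc] using hp.add m i
  | succ c ih =>
    have hW := (h.stateOp n j).monotone hf
    have hL := h.levelOp (c + 1)
    -- The next arrival in the same service raises both the level and the number of arrivals already
    -- seen.
    have h2 := ih (j + 1) (m + 1) (by omega)
    have h3 : stateOp s w g n (j + 1) f = levelOp s w g (c + 1) (stateOp s w g n j f) := by
      rw [stateOp]; congr 2; omega
    rw [h3] at h2
    rw [h.genOp_succ, tsum_eq_zero_add'
      (f := fun a => p (m + a) * stateOp s w g n (min (j + 1 + a) (n + 1) - 1) f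
        (x + (j + 1 + a - (n + 1)))) ENNReal.summable]
    -- Given `m` arrivals, the service ends without another one with conditional probability at most
    -- `r`. Stopping gives the smaller value, since operators of nonnegative variables do not
    -- decrease a monotone function.
    refine (mul_add_mul_le_of_weight_le h.add_eq_one (tail_eq_add p m) (hp.tail_le_one m)
      (hp.succ m) ((hL.le_apply hW x).trans ((h.genOp c).le_apply (hL.monotone hW) x))).trans ?_
    refine add_le_add (le_of_eq ?_) (h2.trans (le_of_eq (tsum_congr fun a => ?_)))
    · rw [min_eq_left (by omega)]
      simp only [add_zero, Nat.add_sub_cancel]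
      congr 2
      omega
    · rw [show m + 1 + a = m + (a + 1) by ring, show j + 1 + 1 + a = j + 1 + (a + 1) by ring]

/-- The operators `stateOp` are a subsolution of the equations for the losses. -/
lemma ResidualBound.stateOp_le (h : OffspringWeights s w g r r' b b')
    (hp : ResidualBound p s r') (hb : p 0 = b)
    {n : ℕ} {f : ℕ → ℝ≥0∞} (hf : Monotone f) (j : ℕ) (hj : j ≤ n) (x : ℕ) :
    stateOp s w g n (j + 1) f x ≤
      ∑' a, p a * stateOp s w g n (min (j + 1 + a) (n + 1) - 1) f (x + (j + 1 + a - (n + 1))) := by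
  obtain ⟨c, hc⟩ := Nat.exists_eq_add_of_le hj
  have hc' : n - j = c := by omega
  rw [stateOp, hc']
  cases c with
  | zero =>
    have := hp.genOp_le h hf 0 j 0 hc.symm x
    simpa [hp.tsum_eq_one, levelOp] using this
  | succ c =>
    have h3 : stateOp s w g n (j + 1) f = levelOp s w g (c + 1) (stateOp s w g n j f) := by
      rw [stateOp, hc']
    -- Only the part of the service after its first arrival is an excursion; whether there is a
    -- first arrival is treated exactly, with probabilities `b` and `b'`.
    have h2 := hp.genOp_le (n := n) h hf c (j + 1) 1 (by omega) x
    rw [h3] at h2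
    have ht : ∑' k, p (1 + k) = b' := by
      have h4 := tail_eq_add p 0
      simp only [zero_add, hp.tsum_eq_one, hb, ← h.geom_add_eq_one] at h4
      have hb1 : b ≠ ⊤ := ne_top_of_le_ne_top ENNReal.one_ne_top (h.geom_add_eq_one ▸ le_self_add)
      exact ((ENNReal.add_right_inj hb1).1 h4).symm
    rw [ht] at h2
    rw [h.levelOp_succ, tsum_eq_zero_add' ENNReal.summable]
    refine add_le_add (le_of_eq ?_) (h2.trans (le_of_eq (tsum_congr fun a => ?_)))
    · rw [min_eq_left (by omega), hb]
      simp only [add_zero, Nat.add_sub_cancel]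
      congr 2
      omega
    · rw [show 1 + a = a + 1 by ring, show j + 1 + 1 + a = j + 1 + (a + 1) by ring]

/-- With `r ≥ b` the generations are dominated by the busy periods. -/
lemma ResidualBound.genOp_le_levelOp (h : OffspringWeights s w g r r' b b')
    (hp : ResidualBound p s r') (hb : p 0 = b) {f : ℕ → ℝ≥0∞} (hf : Monotone f) (c x : ℕ) :
    genOp s w c f x ≤ levelOp s w g c f x := by
  cases c with
  | zero => exact le_rfl
  | succ c =>
    have hL := h.levelOp (c + 1)
    have h4 := tail_eq_add p 0
    have h5 := hp.succ 0
    simp only [zero_add, hp.tsum_eq_one, hb] at h4 h5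
    have hb1 : b ≠ ⊤ := ne_top_of_le_ne_top ENNReal.one_ne_top (h.geom_add_eq_one ▸ le_self_add)
    have ht : b' = ∑' k, p (1 + k) := by
      rw [← h.geom_add_eq_one] at h4
      exact (ENNReal.add_right_inj hb1).1 h4
    rw [h.genOp_succ, h.levelOp_succ]
    simpa using mul_add_mul_le_of_weight_le (t := 1) h.add_eq_one h.geom_add_eq_one.symm le_rfl
      (by rwa [ht]) ((hL.le_apply hf x).trans ((h.genOp c).le_apply (hL.monotone hf) x))

end Operators

/-! ### The embedded chain of a busy period -/

/-- The number of losses during the first `K` services. -/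
def lossesUpTo (n : ℕ) (a : ℕ → ℕ) (K : ℕ) : ℕ :=
  ∑ k ∈ Finset.range K, if inSystem n a k = 0 then 0 else inSystem n a k + a k - (n + 1)

lemma inSystem_congr (n : ℕ) {a a' : ℕ → ℕ} {K : ℕ} (h : ∀ k < K, a k = a' k) :
    inSystem n a K = inSystem n a' K := by
  induction K with
  | zero => rfl
  | succ K ih => rw [inSystem, inSystem, ih fun k hk => h k (by omega), h K (by omega)]

lemma inSystem_le (n : ℕ) (a : ℕ → ℕ) (K : ℕ) : inSystem n a K ≤ n + 1 := by
  cases K with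
  | zero => simp [inSystem]
  | succ K => rw [inSystem]; split_ifs <;> omega

lemma lossesUpTo_congr (n : ℕ) {a a' : ℕ → ℕ} {K : ℕ} (h : ∀ k < K, a k = a' k) :
    lossesUpTo n a K = lossesUpTo n a' K := by
  refine Finset.sum_congr rfl fun k hk => ?_
  rw [Finset.mem_range] at hk
  rw [inSystem_congr n fun i hi => h i (hi.trans hk), h k hk]

lemma lossesUpTo_succ (n : ℕ) (a : ℕ → ℕ) (K : ℕ) :
    lossesUpTo n a (K + 1) = lossesUpTo n a K +
      if inSystem n a K = 0 then 0 else inSystem n a K + a K - (n + 1) :=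
  Finset.sum_range_succ _ _

variable {Ω : Type*} [MeasurableSpace Ω]

/-- The first `K` members of a sequence, continued by zeros. -/
def extendZero {K : ℕ} (v : Fin K → ℕ) (k : ℕ) : ℕ := if h : k < K then v ⟨k, h⟩ else 0

lemma extendZero_of_lt {K : ℕ} (u : ℕ → ℕ) {k : ℕ} (h : k < K) :
    extendZero (fun i : Fin K => u i) k = u k := by simp [extendZero, h]

/-- Integration over the last one of independent discrete variables. -/
lemma lintegral_prefix {P : Measure Ω} {a : ℕ → Ω → ℕ} (ha : ∀ k, Measurable (a k))
    {p : ℕ → ℝ≥0∞}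
    (h : ∀ (K : ℕ) (m : ℕ → ℕ), P {ω | ∀ k < K, a k ω = m k} = ∏ k ∈ Finset.range K, p (m k))
    (K : ℕ) (φ : (Fin K → ℕ) → ℕ → ℝ≥0∞) :
    ∫⁻ ω, φ (fun i => a i ω) (a K ω) ∂P = ∫⁻ ω, ∑' b, p b * φ (fun i => a i ω) b ∂P := by
  have hU : Measurable fun ω => (fun i : Fin K => a i ω) := measurable_pi_lambda _ fun i => ha i
  have hUV : Measurable fun ω => ((fun i : Fin K => a i ω), a K ω) := hU.prodMk (ha K)
  have h1 : ∀ v : Fin K → ℕ, P ((fun ω => (fun i : Fin K => a i ω)) ⁻¹' {v})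
      = ∏ k ∈ Finset.range K, p (extendZero v k) := by
    intro v
    rw [← h K (extendZero v)]
    congr 1
    ext ω
    simp only [Set.mem_preimage, Set.mem_singleton_iff, Set.mem_ofPred_eq, funext_iff, Fin.forall_iff]
    exact forall₂_congr fun k hk => by simp [extendZero, hk]
  have h2 : ∀ (v : Fin K → ℕ) (b : ℕ), P ((fun ω => ((fun i : Fin K => a i ω), a K ω)) ⁻¹' {(v, b)})
      = (∏ k ∈ Finset.range K, p (extendZero v k)) * p b := by
    intro v b
    -- The joint law of the prefix `v` and the next value `b` is the product formula at the sequence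
    -- that continues `v` by `b`.
    have := h (K + 1) (fun k => if k = K then b else extendZero v k)
    rw [Finset.prod_range_succ, if_pos rfl, Finset.prod_congr rfl (g := fun k => p (extendZero v k))
      (fun k hk => by rw [if_neg (Finset.mem_range.1 hk).ne])] at this
    rw [← this]
    congr 1
    ext ω
    simp only [Set.mem_preimage, Set.mem_singleton_iff, Set.mem_ofPred_eq, Prod.mk.injEq, funext_iff,
      Fin.forall_iff]
    constructor
    · rintro ⟨h3, h4⟩ k hk
      rcases Nat.lt_succ_iff_lt_or_eq.1 hk with h5 | rfl
      · rw [if_neg h5.ne, h3 k h5]; simp [extendZero, h5]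
      · rw [if_pos rfl, h4]
    · intro h3
      refine ⟨fun k hk => ?_, by simpa using h3 K (by omega)⟩
      have := h3 k (by omega)
      rwa [if_neg hk.ne, extendZero, dif_pos hk] at this
  calc ∫⁻ ω, φ (fun i => a i ω) (a K ω) ∂P
      = ∫⁻ z, φ z.1 z.2 ∂(P.map fun ω => ((fun i : Fin K => a i ω), a K ω)) := by
        rw [lintegral_map (measurable_of_countable _) hUV]
    _ = ∑' z : (Fin K → ℕ) × ℕ,
          φ z.1 z.2 * ((∏ k ∈ Finset.range K, p (extendZero z.1 k)) * p z.2) := by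
        rw [lintegral_countable']
        refine tsum_congr fun z => ?_
        rw [Measure.map_apply hUV (measurableSet_singleton _), h2]
    _ = ∑' v : Fin K → ℕ, (∑' b, p b * φ v b) * ∏ k ∈ Finset.range K, p (extendZero v k) := by
        rw [ENNReal.tsum_prod']
        refine tsum_congr fun v => ?_
        rw [← ENNReal.tsum_mul_right]
        exact tsum_congr fun b => by ring
    _ = ∫⁻ v, ∑' b, p b * φ v b ∂(P.map fun ω => (fun i : Fin K => a i ω)) := by
        rw [lintegral_countable']
        refine tsum_congr fun z => ?_
        rw [Measure.map_apply hU (measurableSet_singleton _), h1]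
    _ = _ := by rw [lintegral_map (measurable_of_countable _) hU]

/-- The transition of the pair (customers in the system, losses so far). -/
noncomputable def transition (p : ℕ → ℝ≥0∞) (n : ℕ) (φ : ℕ → ℕ → ℝ≥0∞) : ℕ → ℕ → ℝ≥0∞
  | 0, l => φ 0 l
  | j + 1, l => ∑' b, p b * φ (min (j + 1 + b) (n + 1) - 1) (l + (j + 1 + b - (n + 1)))

/-- The Markov property: the pair after `K` services is a function of the first `K` arrival numbers,
and the next one is integrated out by `lintegral_prefix`. -/
lemma lintegral_succ {P : Measure Ω} {a : ℕ → Ω → ℕ} (ha : ∀ k, Measurable (a k)) {p : ℕ → ℝ≥0∞}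
    (h : ∀ (K : ℕ) (m : ℕ → ℕ), P {ω | ∀ k < K, a k ω = m k} = ∏ k ∈ Finset.range K, p (m k))
    (hp : ∑' k, p k = 1) (n K : ℕ) (φ : ℕ → ℕ → ℝ≥0∞) :
    ∫⁻ ω, φ (inSystem n (a · ω) (K + 1)) (lossesUpTo n (a · ω) (K + 1)) ∂P =
      ∫⁻ ω, transition p n φ (inSystem n (a · ω) K) (lossesUpTo n (a · ω) K) ∂P := by
  let step : ℕ → ℕ → ℕ → ℝ≥0∞ := fun j l b =>
    φ (if j = 0 then 0 else min (j + b) (n + 1) - 1) (l + if j = 0 then 0 else j + b - (n + 1))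
  have h1 := lintegral_prefix ha h K
    (fun v b => step (inSystem n (extendZero v) K) (lossesUpTo n (extendZero v) K) b)
  have h2 : ∀ ω, inSystem n (extendZero fun i : Fin K => a i ω) K = inSystem n (a · ω) K :=
    fun ω => inSystem_congr n fun k hk => extendZero_of_lt (a · ω) hk
  have h3 : ∀ ω, lossesUpTo n (extendZero fun i : Fin K => a i ω) K = lossesUpTo n (a · ω) K :=
    fun ω => lossesUpTo_congr n fun k hk => extendZero_of_lt (a · ω) hk
  simp only [h2, h3] at h1
  convert! h1 using 1
  · simp only [step, lossesUpTo_succ, inSystem]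
  · refine lintegral_congr fun ω => ?_
    rcases inSystem n (a · ω) K with _ | j
    · simp [transition, step, ENNReal.tsum_mul_right, hp]
    · simp [transition, step]

/-- A busy period does not last forever. -/
lemma tendsto_measure_inSystem_ne_zero {P : Measure Ω} [IsProbabilityMeasure P] {a : ℕ → Ω → ℕ}
    (ha : ∀ k, Measurable (a k)) {p : ℕ → ℝ≥0∞}
    (h : ∀ (K : ℕ) (m : ℕ → ℕ), P {ω | ∀ k < K, a k ω = m k} = ∏ k ∈ Finset.range K, p (m k))
    (hp : ∑' k, p k = 1) (hp0 : p 0 ≠ 0) (n : ℕ) :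
    Filter.Tendsto (fun K => P {ω | inSystem n (a · ω) K ≠ 0}) Filter.atTop (nhds 0) := by
  have hp1 : p 0 ≤ 1 := hp ▸ ENNReal.le_tsum 0
  have hJ : ∀ K, Measurable fun ω => inSystem n (a · ω) K := by
    intro K
    have : (fun ω => inSystem n (a · ω) K)
        = (fun v : Fin K → ℕ => inSystem n (extendZero v) K) ∘ fun ω (i : Fin K) => a i ω :=
      funext fun ω => inSystem_congr n fun k hk => (extendZero_of_lt (a · ω) hk).symm
    rw [this]
    exact (measurable_of_countable _).comp (measurable_pi_lambda _ fun i => ha i)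
  -- The function `t ^ j` serves as a Lyapunov function. With `p 0 = 2 t`, a service without
  -- arrivals already contributes `2 t ^ (j + 1)` from level `j + 1`; one half restores the old
  -- value and the other is a gain of at least `t ^ (n + 1)`.
  set t : ℝ≥0∞ := p 0 / 2 with ht
  have ht2 : p 0 = t + t := (ENNReal.add_halves _).symm
  have ht1 : t ≤ 1 := (le_self_add.trans_eq ht2.symm).trans hp1
  have ht0 : t ≠ 0 := by simp [ht, hp0]
  have hE : ∀ (K : ℕ), MeasurableSet {ω | inSystem n (a · ω) K ≠ 0} := fun K =>
    (hJ K) (measurableSet_singleton 0).compl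
  have hstep : ∀ K, ∫⁻ ω, t ^ inSystem n (a · ω) K ∂P + t ^ (n + 1) * P {ω | inSystem n (a · ω) K ≠ 0}
      ≤ ∫⁻ ω, t ^ inSystem n (a · ω) (K + 1) ∂P := by
    intro K
    rw [lintegral_succ ha h hp n K (fun j _ => t ^ j), ← lintegral_indicator_const (hE K),
      ← lintegral_add_right _ (measurable_const.indicator (hE K))]
    refine lintegral_mono fun ω => ?_
    have hle := inSystem_le n (a · ω) K
    by_cases hj0 : inSystem n (a · ω) K = 0
    · rw [Set.indicator_of_notMem (by simpa using hj0), hj0]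
      simp [transition]
    · rw [Set.indicator_of_mem (by simpa using hj0)]
      obtain ⟨j, hj⟩ := Nat.exists_eq_succ_of_ne_zero hj0
      rw [hj] at hle ⊢
      simp only [transition, Nat.succ_eq_add_one]
      -- Only the event of no arrivals is kept.
      refine le_trans ?_ (ENNReal.le_tsum 0)
      rw [min_eq_left (by omega)]
      simp only [add_zero, Nat.add_sub_cancel, ht2]
      rw [add_mul, ← pow_succ']
      exact add_le_add_right (pow_le_pow_right_of_le_one' ht1 hle) _
  have hsum : ∀ K, t ^ (n + 1) * ∑ k ∈ Finset.range K, P {ω | inSystem n (a · ω) k ≠ 0}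
      ≤ ∫⁻ ω, t ^ inSystem n (a · ω) K ∂P := by
    intro K
    induction K with
    | zero => simp
    | succ K ih =>
      rw [Finset.sum_range_succ, mul_add]
      exact (add_le_add_left ih _).trans (hstep K)
  have hbound : ∀ K, t ^ (n + 1) * ∑ k ∈ Finset.range K, P {ω | inSystem n (a · ω) k ≠ 0} ≤ 1 :=
    fun K => (hsum K).trans <| by
      calc _ ≤ ∫⁻ _, 1 ∂P := lintegral_mono fun ω => pow_le_one' ht1 _
        _ = 1 := by simp
  -- The total gain is at most `1`, so the expected number of services in the busy period is finite.
  refine ENNReal.tendsto_atTop_zero_of_tsum_ne_top ?_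
  have h5 : ∑' k, P {ω | inSystem n (a · ω) k ≠ 0} ≤ (t ^ (n + 1))⁻¹ := by
    rw [ENNReal.tsum_eq_iSup_nat]
    refine iSup_le fun K => ?_
    rw [ENNReal.le_inv_iff_mul_le, mul_comm]
    exact hbound K
  exact ne_top_of_le_ne_top (ENNReal.inv_ne_top.2 (pow_ne_zero _ ht0)) h5

lemma lossesUpTo_le_losses {Ω : Type*} (n : ℕ) (N : ℝ≥0 → Ω → ℕ) (χ : ℕ → Ω → ℝ) (ω : Ω) (K : ℕ) :
    (lossesUpTo n (arrivalsDuring N χ ω) K : ℕ∞) ≤ losses n N χ ω := by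
  have hsum : ∀ f : ℕ → ℕ∞, Summable f := fun f => ⟨_, hasSum_of_isLUB _ isLUB_iSup⟩
  rw [lossesUpTo, losses, Nat.cast_sum]
  refine le_trans (le_of_eq (Finset.sum_congr rfl fun k _ => ?_))
    ((hsum _).sum_le_tsum (Finset.range K) fun k _ => zero_le)
  split_ifs <;> simp

/-- The lower bound for the tail of the number of losses. -/
lemma levelOp_le_measure_losses {s w g : ℕ → ℝ≥0∞} {r r' b b' : ℝ≥0∞} {p : ℕ → ℝ≥0∞}
    (hw : OffspringWeights s w g r r' b b') (hp : ResidualBound p s r') (hb : p 0 = b)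
    (hb0 : b ≠ 0) {P : Measure Ω} [IsProbabilityMeasure P] {N : ℝ≥0 → Ω → ℕ} {χ : ℕ → Ω → ℝ}
    (ha : ∀ k, Measurable fun ω => arrivalsDuring N χ ω k)
    (h : ∀ (K : ℕ) (m : ℕ → ℕ),
      P {ω | ∀ k < K, arrivalsDuring N χ ω k = m k} = ∏ k ∈ Finset.range K, p (m k))
    (n m : ℕ) :
    levelOp s w g n (fun l => if m ≤ l then 1 else 0) 0 ≤ P {ω | (m : ℕ∞) ≤ losses n N χ ω} := by
  set f : ℕ → ℝ≥0∞ := fun l => if m ≤ l then 1 else 0 with hf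
  have hfm : Monotone f := fun x y hxy => by
    simp only [hf]; split_ifs <;> first | omega | simp
  have hf1 : ∀ x, f x ≤ 1 := fun x => by simp only [hf]; split_ifs <;> simp
  set a : ℕ → Ω → ℕ := fun k ω => arrivalsDuring N χ ω k
  set E : ℕ → ℝ≥0∞ := fun K =>
    ∫⁻ ω, stateOp s w g n (inSystem n (a · ω) K) f (lossesUpTo n (a · ω) K) ∂P with hE
  have hE0 : E 0 = levelOp s w g n f 0 := by
    simp [hE, inSystem, lossesUpTo, stateOp]
  -- The subsolution property makes the process a submartingale started at `levelOp s w g n f 0`.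
  have hmono : Monotone E := by
    refine monotone_nat_of_le_succ fun K => ?_
    simp only [hE]
    rw [lintegral_succ ha h hp.tsum_eq_one n K (fun j l => stateOp s w g n j f l)]
    refine lintegral_mono fun ω => ?_
    have hle := inSystem_le n (a · ω) K
    dsimp only
    rcases hj : inSystem n (a · ω) K with _ | j
    · exact le_rfl
    · exact hp.stateOp_le hw hb hfm j (by omega) _
  -- Once the system is empty `stateOp` is the identity and `E K` tests the losses themselves;
  -- before that its integrand is only bounded by `1`, an error that vanishes as `K` grows.
  have hbound : ∀ K, E 0 ≤ P {ω | (m : ℕ∞) ≤ losses n N χ ω} + P {ω | inSystem n (a · ω) K ≠ 0} := by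
    intro K
    refine (hmono (Nat.zero_le K)).trans ?_
    calc E K ≤ ∫⁻ ω, Set.indicator ({ω | (m : ℕ∞) ≤ losses n N χ ω} ∪
          {ω | inSystem n (a · ω) K ≠ 0}) 1 ω ∂P := by
          refine lintegral_mono fun ω => ?_
          by_cases hω : inSystem n (a · ω) K = 0
          · simp only [hω, stateOp]
            simp only [hf]
            split_ifs with h6
            · rw [Set.indicator_of_mem]
              · simp
              · left
                exact le_trans (by exact_mod_cast h6) (lossesUpTo_le_losses n N χ ω K)
            · simp
          · rw [Set.indicator_of_mem (Set.mem_union_right _ hω)]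
            exact (hw.stateOp n _).apply_le_one hf1 _
      _ ≤ P ({ω | (m : ℕ∞) ≤ losses n N χ ω} ∪ {ω | inSystem n (a · ω) K ≠ 0}) :=
          lintegral_indicator_one_le _
      _ ≤ _ := measure_union_le _ _
  rw [← hE0]
  have hlim := (tendsto_measure_inSystem_ne_zero ha h hp.tsum_eq_one (hb ▸ hb0) n).const_add
    (P {ω | (m : ℕ∞) ≤ losses n N χ ω})
  rw [add_zero] at hlim
  exact ge_of_tendsto' hlim hbound

/-! ### The law of the branching sum -/

/-- The law of the sum of `j` independent variables with the weights `w`. -/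
noncomputable def convPow (w : ℕ → ℝ≥0∞) : ℕ → ℕ → ℝ≥0∞
  | 0, k => if k = 0 then 1 else 0
  | j + 1, k => ∑' l, ∑' i, if l + i = k then convPow w j l * w i else 0

lemma tsum_convPow_succ (w : ℕ → ℝ≥0∞) (j : ℕ) (φ : ℕ → ℝ≥0∞) :
    ∑' k, convPow w (j + 1) k * φ k = ∑' l, convPow w j l * ∑' i, w i * φ (l + i) := by
  simp only [convPow, ← ENNReal.tsum_mul_right, ← ENNReal.tsum_mul_left]
  rw [ENNReal.tsum_comm]
  refine tsum_congr fun l => ?_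
  rw [ENNReal.tsum_comm]
  refine tsum_congr fun i => ?_
  rw [tsum_eq_single (l + i)]
  · rw [if_pos rfl, mul_assoc]
  · intro k hk
    rw [if_neg hk.symm, zero_mul]

/-- Composing `j` independent random numbers of copies of `T` uses a total number of copies with the
convolved law. This is what transfers one generation from the process to the operator. -/
lemma IsAveraging.iterate_mix {T : (ℕ → ℝ≥0∞) → ℕ → ℝ≥0∞} (hT : IsAveraging T) (w : ℕ → ℝ≥0∞)
    (j : ℕ) (f : ℕ → ℝ≥0∞) (x : ℕ) :
    (LossQueue.mix w T)^[j] f x = ∑' k, convPow w j k * T^[k] f x := by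
  induction j generalizing f x with
  | zero =>
    rw [tsum_eq_single 0 (fun k hk => by simp [convPow, hk])]
    simp [convPow]
  | succ j ih =>
    rw [Function.iterate_succ_apply, ih, tsum_convPow_succ]
    refine tsum_congr fun l => ?_
    congr 1
    unfold LossQueue.mix
    rw [(hT.iterate l).tsum]
    refine tsum_congr fun i => ?_
    rw [(hT.iterate l).smul, Function.iterate_add_apply]

variable {Ω : Type*} [MeasurableSpace Ω]

/-- Independence of discrete variables as a product formula for integrals. -/
lemma lintegral_of_indepFun {P : Measure Ω} [IsProbabilityMeasure P] {U V : Ω → ℕ}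
    (hU : Measurable U) (hV : Measurable V) (h : IndepFun U V P) (φ : ℕ → ℕ → ℝ≥0∞) :
    ∫⁻ ω, φ (U ω) (V ω) ∂P = ∫⁻ ω, ∑' i, P {ω | V ω = i} * φ (U ω) i ∂P := by
  have h1 := (indepFun_iff_map_prod_eq_prod_map_map hU.aemeasurable hV.aemeasurable).1 h
  calc ∫⁻ ω, φ (U ω) (V ω) ∂P = ∫⁻ z, φ z.1 z.2 ∂(P.map fun ω => (U ω, V ω)) := by
        rw [lintegral_map (measurable_of_countable _) (hU.prodMk hV)]
    _ = ∫⁻ u, ∫⁻ v, φ u v ∂(P.map V) ∂(P.map U) := by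
        have := Measure.isProbabilityMeasure_map (μ := P) hV.aemeasurable
        rw [h1, lintegral_prod _ (measurable_of_countable _).aemeasurable]
    _ = ∫⁻ u, ∑' i, P {ω | V ω = i} * φ u i ∂(P.map U) := by
        refine lintegral_congr fun u => ?_
        rw [lintegral_countable']
        refine tsum_congr fun i => ?_
        rw [Measure.map_apply hV (measurableSet_singleton _), mul_comm]
        rfl
    _ = _ := by rw [lintegral_map (measurable_of_countable _) hU]

/-- The law of a sum of independent identically distributed discrete variables. -/
lemma measure_sum_eq_convPow {P : Measure Ω} [IsProbabilityMeasure P] {Y : ℕ → Ω → ℕ}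
    (hY : ∀ i, Measurable (Y i)) (hind : iIndepFun Y P) {w : ℕ → ℝ≥0∞}
    (hw : ∀ i k, P {ω | Y i ω = k} = w k) (j k : ℕ) :
    P {ω | ∑ i ∈ Finset.range j, Y i ω = k} = convPow w j k := by
  induction j generalizing k with
  | zero => by_cases hk : k = 0 <;> simp [convPow, hk, eq_comm (a := 0)]
  | succ j ih =>
    have hS : Measurable fun ω => ∑ i ∈ Finset.range j, Y i ω :=
      Finset.measurable_fun_sum _ fun i _ => hY i
    have h1 : IndepFun (fun ω => ∑ i ∈ Finset.range j, Y i ω) (Y j) P := by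
      have := hind.indepFun_finsetSum_of_notMem hY (s := Finset.range j) (i := j) (by simp)
      convert! this using 1
      ext ω; simp
    have h2 := lintegral_of_indepFun hS (hY j) h1 (fun l i => if l + i = k then 1 else 0)
    have h3 : ∀ φ : ℕ → ℝ≥0∞, ∫⁻ ω, φ (∑ i ∈ Finset.range j, Y i ω) ∂P
        = ∑' l, convPow w j l * φ l := by
      intro φ
      rw [← lintegral_map (f := φ) (measurable_of_countable _) hS, lintegral_countable']
      refine tsum_congr fun l => ?_
      rw [Measure.map_apply hS (measurableSet_singleton _), mul_comm, ← ih]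
      rfl
    rw [h3 (fun l => ∑' i, P {ω | Y j ω = i} * if l + i = k then 1 else 0)] at h2
    have h4 : P {ω | ∑ i ∈ Finset.range (j + 1), Y i ω = k}
        = ∫⁻ ω, (if ∑ i ∈ Finset.range j, Y i ω + Y j ω = k then 1 else 0) ∂P := by
      rw [← lintegral_indicator_one]
      · refine lintegral_congr fun ω => ?_
        simp [Set.indicator_apply, Finset.sum_range_succ]
      · exact (Finset.measurable_fun_sum _ fun i _ => hY i) (measurableSet_singleton k)
    rw [h4, h2, convPow]
    refine tsum_congr fun l => ?_
    rw [← ENNReal.tsum_mul_left]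
    exact tsum_congr fun i => by rw [hw]; split_ifs <;> simp

/-- Conditioning a function of a random sum on the number of summands. -/
lemma lintegral_random_sum {P : Measure Ω} [IsProbabilityMeasure P] {Y : ℕ → Ω → ℕ} {Z : Ω → ℕ}
    (hY : ∀ i, Measurable (Y i)) (hZ : Measurable Z) (hind : iIndepFun Y P)
    (hZY : IndepFun Z (fun ω i => Y i ω) P) {w : ℕ → ℝ≥0∞}
    (hw : ∀ i k, P {ω | Y i ω = k} = w k) (φ : ℕ → ℝ≥0∞) :
    ∫⁻ ω, φ (∑ i ∈ Finset.range (Z ω), Y i ω) ∂P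
      = ∫⁻ ω, ∑' k, convPow w (Z ω) k * φ k ∂P := by
  have hS : ∀ j, Measurable fun ω => ∑ i ∈ Finset.range j, Y i ω := fun j =>
    Finset.measurable_fun_sum _ fun i _ => hY i
  have hZj : ∀ j, MeasurableSet {ω | Z ω = j} := fun j => hZ (measurableSet_singleton j)
  have hsplit : ∀ ψ : ℕ → Ω → ℝ≥0∞, (∀ j, Measurable (ψ j)) →
      ∫⁻ ω, ψ (Z ω) ω ∂P = ∑' j, ∫⁻ ω, {ω | Z ω = j}.indicator (ψ j) ω ∂P := by
    intro ψ hψ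
    rw [← lintegral_tsum fun j => ((hψ j).indicator (hZj j)).aemeasurable]
    refine lintegral_congr fun ω => ?_
    rw [tsum_eq_single (Z ω)]
    · simp
    · intro j hj
      simp [Ne.symm hj]
  rw [hsplit (fun j ω => φ (∑ i ∈ Finset.range j, Y i ω))
      fun j => (measurable_of_countable φ).comp (hS j),
    hsplit (fun j _ => ∑' k, convPow w j k * φ k) fun j => measurable_const]
  refine tsum_congr fun j => ?_
  have h1 : IndepFun Z (fun ω => ∑ i ∈ Finset.range j, Y i ω) P :=
    hZY.comp (ψ := fun v : ℕ → ℕ => ∑ i ∈ Finset.range j, v i) measurable_id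
      (Finset.measurable_fun_sum _ fun i _ => measurable_pi_apply i)
  have h2 := lintegral_of_indepFun hZ (hS j) h1 (fun z k => if z = j then φ k else 0)
  simp only [measure_sum_eq_convPow hY hind hw] at h2
  have h3 : ∀ ω, {ω | Z ω = j}.indicator (fun ω => φ (∑ i ∈ Finset.range j, Y i ω)) ω
      = if Z ω = j then φ (∑ i ∈ Finset.range j, Y i ω) else 0 := fun ω => by
    simp [Set.indicator_apply]
  simp only [h3, h2]
  refine lintegral_congr fun ω => ?_
  by_cases hz : Z ω = j <;> simp [hz]

variable {q : PMF ℕ} {lam : ℝ} {G : Measure ℝ} {X : ℕ → ℕ → Ω → ℕ} {ς : ℕ → Ω → ℕ} {P : Measure Ω}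

lemma measurable_random_sum {Ω : Type*} [MeasurableSpace Ω] {Y : ℕ → Ω → ℕ} {Z : Ω → ℕ}
    (hY : ∀ i, Measurable (Y i)) (hZ : Measurable Z) :
    Measurable fun ω => ∑ i ∈ Finset.range (Z ω), Y i ω := by
  have h1 : Measurable fun z : ℕ × Ω => ∑ i ∈ Finset.range z.1, Y i z.2 :=
    measurable_from_prod_countable_right fun j =>
      Finset.measurable_fun_sum (Finset.range j) fun i _ => hY i
  exact h1.comp (hZ.prodMk measurable_id)

lemma measurable_generationSize (hX : ∀ k i, Measurable (X k i)) (n : ℕ) :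
    Measurable (generationSize X n) := by
  induction n with
  | zero => exact measurable_const
  | succ n ih => exact measurable_random_sum (hX n) ih

/-- Each block generates the supremum of the σ-algebras of its members, and such suprema over
disjoint index sets are independent. -/
lemma _root_.ProbabilityTheory.iIndepFun.indepFun_restrict {ι : Type*} {V : ι → Ω → ℕ}
    (h : iIndepFun V P) (hV : ∀ i, Measurable (V i)) {A A' : Set ι} (hA : Disjoint A A') :
    IndepFun (fun ω (a : A) => V a ω) (fun ω (a : A') => V a ω) P := by
  have key : ∀ A : Set ι, MeasurableSpace.comap (fun ω (a : A) => V a ω) MeasurableSpace.pi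
      = ⨆ i ∈ A, MeasurableSpace.comap (V i) inferInstance := by
    intro A
    rw [MeasurableSpace.pi, MeasurableSpace.comap_iSup, iSup_subtype']
    exact iSup_congr fun a => MeasurableSpace.comap_comp
  rw [IndepFun_iff_Indep, key, key]
  exact indep_iSup_of_disjoint (fun i => (hV i).comap_le) h hA

/-- The size of a generation is independent of variables that do not enter its construction. -/
lemma IsBranchingInput.indepFun_generationSize [IsProbabilityMeasure P]
    (h : IsBranchingInput q lam G X ς P) (n : ℕ) (c : ℕ → (ℕ × ℕ) ⊕ ℕ)
    (hc : ∀ i k l, c i = Sum.inl (k, l) → n ≤ k) :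
    IndepFun (generationSize X n)
      (fun ω i => Sum.elim (fun a : ℕ × ℕ => X a.1 a.2) (fun i => ς i) (c i) ω) P := by
  set V : (ℕ × ℕ) ⊕ ℕ → Ω → ℕ := Sum.elim (fun a : ℕ × ℕ => X a.1 a.2) (fun i => ς i) with hV
  have hm : ∀ a, Measurable (V a) := by
    rintro (a | i)
    · exact h.measurable_offspring _ _
    · exact h.measurable_summand _
  -- Generation `n` is built from the offspring numbers of the generations before it.
  let A : Set ((ℕ × ℕ) ⊕ ℕ) := {a | ∃ k l, k < n ∧ a = Sum.inl (k, l)}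
  let A' : Set ((ℕ × ℕ) ⊕ ℕ) := Set.range c
  have hAA' : Disjoint A A' := by
    rw [Set.disjoint_left]
    rintro _ ⟨k, l, hk, rfl⟩ ⟨i, hi⟩
    exact absurd (hc i k l hi) (by omega)
  have hmain : IndepFun (fun ω (a : A) => V a ω) (fun ω (a : A') => V a ω) P :=
    h.indep.indepFun_restrict hm hAA'
  have hgen : ∀ m ≤ n, ∃ ψ : (A → ℕ) → ℕ, Measurable ψ ∧
      generationSize X m = ψ ∘ fun ω (a : A) => V a ω := by
    intro m hmn
    induction m with
    | zero => exact ⟨fun _ => 1, measurable_const, rfl⟩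
    | succ m ih =>
      obtain ⟨ψ, hψ, hψ'⟩ := ih (by omega)
      refine ⟨fun v => ∑ i ∈ Finset.range (ψ v), v ⟨Sum.inl (m, i), m, i, by omega, rfl⟩, ?_, ?_⟩
      · exact measurable_random_sum (Y := fun i v => v ⟨Sum.inl (m, i), m, i, by omega, rfl⟩)
          (fun i => measurable_pi_apply _) hψ
      · funext ω
        simp only [generationSize, hψ', Function.comp_apply, hV, Sum.elim_inl]
  obtain ⟨ψ, hψ, hψ'⟩ := hgen n le_rfl
  rw [hψ']
  exact hmain.comp (ψ := fun v i => v ⟨c i, i, rfl⟩) hψ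
    (measurable_pi_lambda _ fun i => measurable_pi_apply _)

/-- The law of a random sum over the last generation. -/
lemma IsBranchingInput.lintegral_sum [IsProbabilityMeasure P]
    (h : IsBranchingInput q lam G X ς P) {s : ℕ → ℝ≥0∞} (hs : ∀ i m, P {ω | ς i ω = m} = s m)
    (n : ℕ) (f : ℕ → ℝ≥0∞) :
    ∫⁻ ω, f (∑ i ∈ Finset.range (generationSize X n ω), ς i ω) ∂P = genOp s q n f 0 := by
  have hs1 : ∑' k, s k = 1 := by
    have hm := h.measurable_summand 0
    have := Measure.isProbabilityMeasure_map (μ := P) hm.aemeasurable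
    have h1 : ∑' k, (P.map (ς 0)) {k} = P.map (ς 0) Set.univ := by
      have := lintegral_countable' (μ := P.map (ς 0)) (fun _ => 1)
      simpa using this.symm
    rw [measure_univ] at h1
    rw [← h1]
    refine tsum_congr fun k => ?_
    rw [Measure.map_apply hm (measurableSet_singleton _), ← hs 0]
    rfl
  have hav : ∀ c, IsAveraging (genOp s q c) := fun c => by
    induction c with
    | zero => exact isAveraging_shift.mix hs1
    | succ c ih => exact ih.mix q.tsum_coe
  have hX : ∀ k i m, P {ω | X k i ω = m} = q m := fun k i m => by
    rw [← PMF.toMeasure_apply_singleton q m (measurableSet_singleton m),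
      ← (h.law_offspring k i).map_eq,
      Measure.map_apply (h.measurable_offspring k i) (measurableSet_singleton _)]
    rfl
  -- Conditioning on generation `m` replaces each of its members by a random number of copies of
  -- `genOp c`, that is, by one copy of `genOp (c + 1)`.
  have hstep : ∀ m c, ∫⁻ ω, (genOp s q c)^[generationSize X (m + 1) ω] f 0 ∂P
      = ∫⁻ ω, (genOp s q (c + 1))^[generationSize X m ω] f 0 ∂P := by
    intro m c
    have h1 := lintegral_random_sum (P := P) (h.measurable_offspring m)
      (measurable_generationSize h.measurable_offspring m)
      (h.indep.precomp (g := fun i => Sum.inl (m, i)) (fun i j hij => by simpa using hij))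
      (h.indepFun_generationSize m (fun i => Sum.inl (m, i)) (fun i k l hi => by simp at hi; omega))
      (hX m) (fun k => (genOp s q c)^[k] f 0)
    simp only [generationSize]
    rw [h1]
    refine lintegral_congr fun ω => ?_
    rw [genOp, (hav c).iterate_mix]
  have hiter : ∀ m c, ∫⁻ ω, (genOp s q c)^[generationSize X m ω] f 0 ∂P = genOp s q (c + m) f 0 := by
    intro m
    induction m with
    | zero => intro c; simp [generationSize]
    | succ m ih => intro c; rw [hstep, ih, add_assoc, add_comm 1]
  rw [← zero_add n, ← hiter n 0]
  have h1 := lintegral_random_sum (P := P) h.measurable_summand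
    (measurable_generationSize h.measurable_offspring n)
    (h.indep.precomp (g := fun i => Sum.inr i) (fun i j hij => by simpa using hij))
    (h.indepFun_generationSize n (fun i => Sum.inr i) (fun i k l hi => by simp at hi)) hs f
  rw [zero_add, h1]
  refine lintegral_congr fun ω => ?_
  rw [genOp, isAveraging_shift.iterate_mix]
  exact tsum_congr fun k => by rw [shift_iterate, zero_add]

/-! ### Poisson arrivals between random service ends -/

open Filter Topology

/-- The first point after `s` of the grid with mesh `1 / (j + 1)`. -/
noncomputable def gridAfter (j : ℕ) (s : ℝ≥0) : ℝ≥0 := ((⌊(j + 1) * s⌋₊ : ℝ≥0) + 1) / (j + 1)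

/-- The approach is from the right, the side on which the counting paths are continuous. -/
lemma tendsto_gridAfter (s : ℝ≥0) : Tendsto (gridAfter · s) atTop (𝓝[≥] s) := by
  have hpos : ∀ j : ℕ, (0 : ℝ≥0) < j + 1 := fun j => by positivity
  refine tendsto_nhdsWithin_iff.2 ⟨?_, Eventually.of_forall fun j => ?_⟩
  · have hlim : Tendsto (fun j : ℕ => s + 1 / ((j : ℝ≥0) + 1)) atTop (𝓝 s) := by
      simpa using (tendsto_one_div_add_atTop_nhds_zero_nat (𝕜 := ℝ≥0)).const_add s
    refine tendsto_of_tendsto_of_tendsto_of_le_of_le tendsto_const_nhds hlim (fun j => ?_)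
      fun j => ?_
    · rw [gridAfter, le_div_iff₀ (hpos j), mul_comm]
      exact (Nat.lt_floor_add_one _).le
    · rw [gridAfter, div_le_iff₀ (hpos j), add_mul s, one_div_mul_cancel (hpos j).ne', mul_comm s]
      exact add_le_add_left (Nat.floor_le zero_le) 1
  · rw [Set.mem_Ici, gridAfter, le_div_iff₀ (hpos j), mul_comm]
    exact (Nat.lt_floor_add_one _).le

lemma measurable_gridAfter (j : ℕ) : Measurable (gridAfter j) := by
  unfold gridAfter
  have : Measurable fun s : ℝ≥0 => (⌊((j : ℝ≥0) + 1) * s⌋₊ : ℝ≥0) :=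
    (measurable_of_countable (fun n : ℕ => (n : ℝ≥0))).comp
      (Nat.measurable_floor.comp (measurable_const_mul _))
  exact (this.add_const 1).div_const _

/-- The weights of the Poisson law with mean `lam * x`. -/
noncomputable def poissonWeight (lam : ℝ) (m : ℕ) (x : ℝ) : ℝ :=
  Real.exp (-(lam * x)) * (lam * x) ^ m / (m.factorial : ℝ)

lemma poissonMeasure_eq_poissonWeight {lam : ℝ} (hlam : 0 ≤ lam) (x : ℝ≥0) (m : ℕ) :
    poissonMeasure (lam.toNNReal * x) {m} = ENNReal.ofReal (poissonWeight lam m x) := by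
  rw [poissonMeasure_singleton, poissonWeight, NNReal.coe_mul, Real.coe_toNNReal _ hlam]

lemma measurable_poissonWeight (lam : ℝ) (m : ℕ) : Measurable (poissonWeight lam m) := by
  unfold poissonWeight; fun_prop

lemma poissonWeight_nonneg {lam : ℝ} (hlam : 0 ≤ lam) (m : ℕ) {x : ℝ} (hx : 0 ≤ x) :
    0 ≤ poissonWeight lam m x := by
  unfold poissonWeight; positivity

lemma poissonWeight_le_one {lam : ℝ} (hlam : 0 ≤ lam) (m : ℕ) {x : ℝ} (hx : 0 ≤ x) :
    poissonWeight lam m x ≤ 1 := by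
  lift x to ℝ≥0 using hx
  rw [← ENNReal.ofReal_le_one, ← poissonMeasure_eq_poissonWeight hlam]
  exact prob_le_one

lemma ofReal_mixedPoisson {lam : ℝ} (hlam : 0 ≤ lam) (Q : Measure ℝ) [IsFiniteMeasure Q] (m : ℕ) :
    ENNReal.ofReal (mixedPoisson lam Q m)
      = ∫⁻ x in Set.Ici 0, ENNReal.ofReal (poissonWeight lam m x) ∂Q := by
  refine ofReal_integral_eq_lintegral_ofReal ?_ ?_
  · refine Measure.integrableOn_of_bounded (M := 1) (measure_ne_top _ _)
      (measurable_poissonWeight lam m).aestronglyMeasurable ?_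
    filter_upwards [ae_restrict_mem measurableSet_Ici] with x hx
    have := poissonWeight_nonneg hlam m hx
    have h1 := poissonWeight_le_one hlam m hx
    unfold poissonWeight at this h1
    rwa [Real.norm_of_nonneg this]
  · filter_upwards [ae_restrict_mem measurableSet_Ici] with x hx
    exact poissonWeight_nonneg hlam m hx

variable {Ω : Type*} [MeasurableSpace Ω] {P : Measure Ω} {lam : ℝ} {N : ℝ≥0 → Ω → ℕ}

lemma measurableSet_forall_lt_eq {Ω : Type*} [MeasurableSpace Ω] {f : ℕ → Ω → ℕ}
    (hf : ∀ k, Measurable (f k)) (K : ℕ) (m : ℕ → ℕ) :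
    MeasurableSet {ω | ∀ k < K, f k ω = m k} := by
  have : {ω | ∀ k < K, f k ω = m k} = ⋂ k, ⋂ (_ : k < K), f k ⁻¹' {m k} := by ext ω; simp
  rw [this]
  exact MeasurableSet.iInter fun k => MeasurableSet.iInter fun _ =>
    hf k (measurableSet_singleton _)

lemma measurableSet_increments (t : ℕ → ℝ≥0) (K : ℕ) (m : ℕ → ℕ) :
    MeasurableSet {f : ℝ≥0 → ℕ | ∀ k < K, f (t (k + 1)) - f (t k) = m k} :=
  measurableSet_forall_lt_eq
    (fun k => (measurable_pi_apply (t (k + 1))).sub (measurable_pi_apply (t k))) K m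

lemma IsPoissonProcess.measure_increments (h : IsPoissonProcess lam N P) {t : ℕ → ℝ≥0}
    (ht : Monotone t) (K : ℕ) (m : ℕ → ℕ) :
    P {ω | ∀ k < K, N (t (k + 1)) ω - N (t k) ω = m k}
      = ∏ k ∈ Finset.range K, poissonMeasure (lam.toNNReal * (t (k + 1) - t k)) {m k} := by
  have h1 := (h.indep_increments.nat ht).measure_inter_preimage_eq_mul (Finset.range K)
    (sets := fun k => {m k}) fun _ _ => measurableSet_singleton _
  have h2 : ∀ k, P ((fun ω => N (t (k + 1)) ω - N (t k) ω) ⁻¹' {m k})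
      = poissonMeasure (lam.toNNReal * (t (k + 1) - t k)) {m k} := fun k => by
    rw [← (h.law_increment (t k) (t (k + 1)) (ht (Nat.le_succ k))).map_eq]
    exact (Measure.map_apply ((h.measurable _).sub (h.measurable _))
      (measurableSet_singleton _)).symm
  rw [← Finset.prod_congr rfl fun k _ => h2 k, ← h1]
  congr 1
  ext ω
  simp

lemma IsPoissonProcess.eventually_gridAfter (h : IsPoissonProcess lam N P) (ω : Ω) (s : ℝ≥0) :
    ∀ᶠ j in atTop, N (gridAfter j s) ω = N s ω := by
  have h1 : Tendsto (fun j => N (gridAfter j s) ω) atTop (𝓝 (N s ω)) :=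
    (h.right_continuous ω s).tendsto.comp (tendsto_gridAfter s)
  simpa using h1

lemma IsPoissonProcess.measurable_gridAfter (h : IsPoissonProcess lam N P) {τ : Ω → ℝ≥0}
    (hτ : Measurable τ) (j : ℕ) : Measurable fun ω => N (gridAfter j (τ ω)) ω := by
  have h1 : Measurable fun z : ℕ × Ω => N (((z.1 : ℝ≥0) + 1) / (j + 1)) z.2 :=
    measurable_from_prod_countable_right fun i => h.measurable (((i : ℝ≥0) + 1) / (j + 1))
  have h2 : Measurable fun ω => (⌊((j : ℝ≥0) + 1) * τ ω⌋₊, ω) :=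
    (Nat.measurable_floor.comp (hτ.const_mul _)).prodMk measurable_id
  have h3 : (fun ω => N (gridAfter j (τ ω)) ω)
      = (fun z : ℕ × Ω => N (((z.1 : ℝ≥0) + 1) / (j + 1)) z.2) ∘
        fun ω => (⌊((j : ℝ≥0) + 1) * τ ω⌋₊, ω) := by
    funext ω
    simp only [gridAfter, Function.comp_apply]
  rw [h3]
  exact h1.comp h2

lemma IsPoissonProcess.measurable_comp (h : IsPoissonProcess lam N P) {τ : Ω → ℝ≥0}
    (hτ : Measurable τ) : Measurable fun ω => N (τ ω) ω := by
  refine measurable_of_tendsto_metrizable (fun j => h.measurable_gridAfter hτ j)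
    (tendsto_pi_nhds.2 fun ω => ?_)
  exact tendsto_const_nhds.congr' ((h.eventually_gridAfter ω (τ ω)).mono fun j hj => hj.symm)

lemma measurable_serviceEnd {χ : ℕ → Ω → ℝ} (hχ : ∀ k, Measurable (χ k)) (k : ℕ) :
    Measurable (serviceEnd χ k) :=
  (Finset.measurable_fun_sum _ fun i _ => hχ i).real_toNNReal

variable {B : Measure ℝ} {χ : ℕ → Ω → ℝ}

lemma IsQueueInput.measurable_arrivalsDuring (h : IsQueueInput lam B N χ P) (k : ℕ) :
    Measurable fun ω => arrivalsDuring N χ ω k :=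
  (h.arrivals.measurable_comp (measurable_serviceEnd h.measurable_service _)).sub
    (h.arrivals.measurable_comp (measurable_serviceEnd h.measurable_service _))

lemma IsQueueInput.ae_service_nonneg (h : IsQueueInput lam B N χ P) (hB : B (Set.Iic 0) = 0) :
    ∀ᵐ ω ∂P, ∀ k, 0 ≤ χ k ω := by
  refine ae_all_iff.2 fun k => ?_
  have h1 : ∀ᵐ x ∂(P.map (χ k)), 0 ≤ x := by
    rw [(h.law_service k).map_eq, ae_iff]
    exact measure_mono_null (fun x hx => le_of_lt (not_le.1 hx)) hB
  exact ae_of_ae_map (h.measurable_service k).aemeasurable h1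

lemma monotone_serviceEnd {Ω : Type*} {χ : ℕ → Ω → ℝ} {ω : Ω} (h : ∀ k, 0 ≤ χ k ω) : Monotone fun k => serviceEnd χ k ω := by
  refine monotone_nat_of_le_succ fun k => Real.toNNReal_mono ?_
  rw [Finset.sum_range_succ]
  linarith [h k]

/-- The numbers of arrivals between the grid points that follow the ends of the services. -/
lemma IsQueueInput.measure_gridAfter [IsProbabilityMeasure P] (h : IsQueueInput lam B N χ P)
    (hB : B (Set.Iic 0) = 0) (j K : ℕ) (m : ℕ → ℕ) :
    P {ω | ∀ k < K, N (gridAfter j (serviceEnd χ (k + 1) ω)) ω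
        - N (gridAfter j (serviceEnd χ k ω)) ω = m k}
      = ∫⁻ ω, ∏ k ∈ Finset.range K, poissonMeasure (lam.toNNReal *
          (gridAfter j (serviceEnd χ (k + 1) ω) - gridAfter j (serviceEnd χ k ω))) {m k} ∂P := by
  -- The grid indices of the service ends take countably many values. On each fibre the observation
  -- times are deterministic, so independence of `N` and `χ` applies.
  let u : (ℕ → ℝ) → Fin (K + 1) → ℕ := fun c i =>
    ⌊((j : ℝ≥0) + 1) * (∑ l ∈ Finset.range i, c l).toNNReal⌋₊
  have hu : Measurable u := measurable_pi_lambda _ fun i => Nat.measurable_floor.comp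
    ((Finset.measurable_fun_sum _ fun l _ => measurable_pi_apply l).real_toNNReal.const_mul _)
  let U : Ω → Fin (K + 1) → ℕ := fun ω => u fun k => χ k ω
  have hU : Measurable U := hu.comp (measurable_pi_lambda _ h.measurable_service)
  let t : (Fin (K + 1) → ℕ) → ℕ → ℝ≥0 := fun v i => ((v ⟨min i K, by omega⟩ : ℝ≥0) + 1) / (j + 1)
  have htU : ∀ ω, ∀ k ≤ K, t (U ω) k = gridAfter j (serviceEnd χ k ω) := by
    intro ω k hk
    simp only [t, U, u, gridAfter, serviceEnd, min_eq_left hk]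
  set E : Set Ω := {ω | ∀ k < K, N (gridAfter j (serviceEnd χ (k + 1) ω)) ω
        - N (gridAfter j (serviceEnd χ k ω)) ω = m k} with hE
  let g : (Fin (K + 1) → ℕ) → ℝ≥0∞ := fun v =>
    ∏ k ∈ Finset.range K, poissonMeasure (lam.toNNReal * (t v (k + 1) - t v k)) {m k}
  have hfiber : ∀ v, P (E ∩ U ⁻¹' {v}) = g v * P (U ⁻¹' {v}) := by
    intro v
    let S : Set (ℝ≥0 → ℕ) := {f | ∀ k < K, f (t v (k + 1)) - f (t v k) = m k}
    have hS : MeasurableSet S := measurableSet_increments (t v) K m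
    have h1 : E ∩ U ⁻¹' {v} = (fun ω => fun s : ℝ≥0 => N s ω) ⁻¹' S ∩
        (fun ω => fun k : ℕ => χ k ω) ⁻¹' (u ⁻¹' {v}) := by
      ext ω
      simp only [Set.mem_inter_iff, Set.mem_preimage, Set.mem_singleton_iff]
      refine and_congr_left fun hω => forall₂_congr fun k hk => ?_
      have hω' : U ω = v := hω
      rw [← htU ω k hk.le, ← htU ω (k + 1) hk, hω']
    rw [h1, h.indep.measure_inter_preimage_eq_mul _ _ hS (hu (measurableSet_singleton v))]
    -- The Poisson formula needs ordered times; unordered index vectors have probability `0` because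
    -- services are almost surely nonnegative.
    by_cases hv : Monotone v
    · have ht : Monotone (t v) := by
        intro a b hab
        have h3 : v ⟨min a K, by omega⟩ ≤ v ⟨min b K, by omega⟩ :=
          hv (by simp only [Fin.mk_le_mk]; omega)
        simp only [t]
        gcongr
      congr 1
      exact h.arrivals.measure_increments ht K m
    · have h2 : P (U ⁻¹' {v}) = 0 := by
        refine measure_mono_null ?_ (ae_iff.1 (h.ae_service_nonneg hB))
        intro ω hω hnn
        refine hv ?_
        have hω' : U ω = v := hω
        rw [← hω']
        intro a b hab
        simp only [U, u]
        have h4 := monotone_serviceEnd (χ := χ) hnn (show (a : ℕ) ≤ b from hab)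
        simp only [serviceEnd] at h4
        gcongr
      change _ * P (U ⁻¹' {v}) = g v * P (U ⁻¹' {v})
      rw [h2, mul_zero, mul_zero]
  have hEm : MeasurableSet E := measurableSet_forall_lt_eq (fun k =>
    (h.arrivals.measurable_gridAfter (measurable_serviceEnd h.measurable_service (k + 1)) j).sub
      (h.arrivals.measurable_gridAfter (measurable_serviceEnd h.measurable_service k) j)) K m
  have hUm : ∀ v, MeasurableSet (U ⁻¹' {v}) := fun v => hU (measurableSet_singleton v)
  calc P E = P (⋃ v, E ∩ U ⁻¹' {v}) := by
        congr 1; ext ω; simp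
    _ = ∑' v, P (E ∩ U ⁻¹' {v}) := by
        refine measure_iUnion (fun v w hvw => ?_) fun v => hEm.inter (hUm v)
        refine Set.disjoint_left.2 fun ω h1 h2 => hvw ?_
        exact (h1.2 : U ω = v).symm.trans h2.2
    _ = ∑' v, g v * P.map U {v} := by
        refine tsum_congr fun v => ?_
        rw [hfiber, Measure.map_apply hU (measurableSet_singleton v)]
    _ = ∫⁻ ω, g (U ω) ∂P := by
        rw [← lintegral_countable', lintegral_map (measurable_of_countable _) hU]
    _ = _ := by
        refine lintegral_congr fun ω => Finset.prod_congr rfl fun k hk => ?_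
        have hk' := Finset.mem_range.1 hk
        rw [htU ω k hk'.le, htU ω (k + 1) hk']

/-- The numbers of arrivals during the services are independent and have the mixed Poisson law. -/
lemma IsQueueInput.measure_arrivalsDuring [IsProbabilityMeasure P] [IsProbabilityMeasure B]
    (h : IsQueueInput lam B N χ P) (hlam : 0 ≤ lam)
    (hB : B (Set.Iic 0) = 0) (K : ℕ) (m : ℕ → ℕ) :
    P {ω | ∀ k < K, arrivalsDuring N χ ω k = m k}
      = ∏ k ∈ Finset.range K, ENNReal.ofReal (mixedPoisson lam B (m k)) := by
  have hτ := fun k => measurable_serviceEnd (Ω := Ω) h.measurable_service k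
  have hleft : Tendsto (fun j : ℕ => P {ω | ∀ k < K, N (gridAfter j (serviceEnd χ (k + 1) ω)) ω
        - N (gridAfter j (serviceEnd χ k ω)) ω = m k}) atTop
      (𝓝 (P {ω | ∀ k < K, arrivalsDuring N χ ω k = m k})) := by
    refine tendsto_measure_of_tendsto_indicator_of_isFiniteMeasure atTop P (fun j => ?_) fun ω => ?_
    · exact measurableSet_forall_lt_eq (fun k => (h.arrivals.measurable_gridAfter (hτ _) j).sub
        (h.arrivals.measurable_gridAfter (hτ _) j)) K m
    · have h1 : ∀ᶠ j in atTop, ∀ k ∈ Finset.range (K + 1),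
          N (gridAfter j (serviceEnd χ k ω)) ω = N (serviceEnd χ k ω) ω :=
        (Filter.eventually_all_finset _).2 fun k _ => h.arrivals.eventually_gridAfter ω _
      filter_upwards [h1] with j hj
      refine forall₂_congr fun k hk => ?_
      rw [hj k (by simp; omega), hj (k + 1) (by simp; omega), arrivalsDuring]
  have hcont : ∀ i : ℕ, Continuous fun x : ℝ≥0 => poissonMeasure (lam.toNNReal * x) {i} := by
    intro i
    simp only [poissonMeasure_eq_poissonWeight hlam]
    refine ENNReal.continuous_ofReal.comp ?_
    unfold poissonWeight
    fun_prop
  have hright : Tendsto (fun j : ℕ => ∫⁻ ω, ∏ k ∈ Finset.range K, poissonMeasure (lam.toNNReal *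
          (gridAfter j (serviceEnd χ (k + 1) ω) - gridAfter j (serviceEnd χ k ω))) {m k} ∂P) atTop
      (𝓝 (∫⁻ ω, ∏ k ∈ Finset.range K, poissonMeasure (lam.toNNReal *
          (serviceEnd χ (k + 1) ω - serviceEnd χ k ω)) {m k} ∂P)) := by
    refine tendsto_lintegral_of_dominated_convergence (fun _ => 1) (fun j => ?_) (fun j => ?_)
      (by simp) ?_
    · refine Finset.measurable_fun_prod _ fun k _ => (hcont (m k)).measurable.comp ?_
      exact ((measurable_gridAfter j).comp (hτ _)).sub ((measurable_gridAfter j).comp (hτ _))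
    · exact Eventually.of_forall fun ω => Finset.prod_le_one' fun k _ => prob_le_one
    · refine Eventually.of_forall fun ω => ?_
      have hlim : ∀ k, Tendsto (fun j => gridAfter j (serviceEnd χ k ω)) atTop
          (𝓝 (serviceEnd χ k ω)) := fun k =>
        (tendsto_gridAfter _).mono_right nhdsWithin_le_nhds
      have h1 : ∀ k, Tendsto (fun j => poissonMeasure (lam.toNNReal *
          (gridAfter j (serviceEnd χ (k + 1) ω) - gridAfter j (serviceEnd χ k ω))) {m k}) atTop
          (𝓝 (poissonMeasure (lam.toNNReal * (serviceEnd χ (k + 1) ω - serviceEnd χ k ω)) {m k})) :=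
        fun k => ((hcont (m k)).tendsto _).comp ((hlim (k + 1)).sub (hlim k))
      generalize Finset.range K = s
      induction s using Finset.cons_induction with
      | empty => simp
      | cons a s ha ih =>
        simp only [Finset.prod_cons]
        exact ENNReal.Tendsto.mul (h1 a) (Or.inr (ne_top_of_le_ne_top ENNReal.one_ne_top
          (Finset.prod_le_one' fun k _ => prob_le_one))) ih (Or.inr (measure_ne_top _ _))
  -- As the mesh shrinks, right continuity handles the events on the left, and continuity of the
  -- Poisson weights in the mean handles the integrals on the right.
  have heq := tendsto_nhds_unique hleft (hright.congr fun j => (h.measure_gridAfter hB j K m).symm)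
  rw [heq]
  have h2 : ∫⁻ ω, ∏ k ∈ Finset.range K, poissonMeasure (lam.toNNReal *
          (serviceEnd χ (k + 1) ω - serviceEnd χ k ω)) {m k} ∂P
      = ∫⁻ ω, ∏ k ∈ Finset.range K, ENNReal.ofReal (poissonWeight lam (m k) (χ k ω)) ∂P := by
    refine lintegral_congr_ae ?_
    filter_upwards [h.ae_service_nonneg hB] with ω hω
    refine Finset.prod_congr rfl fun k _ => ?_
    rw [poissonMeasure_eq_poissonWeight hlam]
    congr 2
    have hs : ∀ i, (serviceEnd χ i ω : ℝ) = ∑ l ∈ Finset.range i, χ l ω := fun i =>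
      Real.coe_toNNReal _ (Finset.sum_nonneg fun l _ => hω l)
    rw [NNReal.coe_sub (monotone_serviceEnd hω (Nat.le_succ k)), hs, hs, Finset.sum_range_succ]
    ring
  have hmw : ∀ k, Measurable fun x => ENNReal.ofReal (poissonWeight lam (m k) x) := fun k =>
    (measurable_poissonWeight lam (m k)).ennreal_ofReal
  rw [h2, lintegral_prod_eq_prod_lintegral_of_indepFun (Finset.range K)
    (fun k ω => ENNReal.ofReal (poissonWeight lam (m k) (χ k ω)))
    (h.indep_service.comp (fun k x => ENNReal.ofReal (poissonWeight lam (m k) x)) hmw)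
    fun k => (hmw k).comp (h.measurable_service k)]
  refine Finset.prod_congr rfl fun k _ => ?_
  rw [ofReal_mixedPoisson hlam, ← lintegral_map (hmw k) (h.measurable_service k),
    (h.law_service k).map_eq, Measure.restrict_eq_self_of_ae_mem]
  rw [ae_iff]
  exact measure_mono_null (fun x (hx : ¬ 0 ≤ x) => le_of_lt (not_le.1 hx)) hB

/-! ### Erlang times and tails of mixed Poisson laws -/

/-- The density of the Erlang law with `i + 1` stages of rate `lam`. -/
noncomputable def erlangPDF (lam : ℝ) (i : ℕ) (x : ℝ) : ℝ :=
  lam ^ (i + 1) * x ^ i / (i.factorial : ℝ) * Real.exp (-(lam * x))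

/-- The expectation of `φ` for the Erlang law with `i + 1` stages of rate `lam`. -/
noncomputable def erlangMean (lam : ℝ) (i : ℕ) (φ : ℝ → ℝ≥0∞) : ℝ≥0∞ :=
  ∫⁻ x in Set.Ioi 0, ENNReal.ofReal (erlangPDF lam i x) * φ x

/-- The survival function. -/
noncomputable def surv (Q : Measure ℝ) (x : ℝ) : ℝ≥0∞ := Q (Set.Ioi x)

lemma measurable_surv (Q : Measure ℝ) : Measurable (surv Q) :=
  Antitone.measurable fun _ _ hxy => measure_mono (Set.Ioi_subset_Ioi hxy)

@[fun_prop]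
lemma measurable_erlangPDF (lam : ℝ) (i : ℕ) : Measurable (erlangPDF lam i) := by
  unfold erlangPDF; fun_prop

lemma continuous_erlangPDF (lam : ℝ) (i : ℕ) : Continuous (erlangPDF lam i) := by
  unfold erlangPDF; fun_prop

lemma erlangPDF_nonneg {lam : ℝ} (hlam : 0 ≤ lam) (i : ℕ) {x : ℝ} (hx : 0 ≤ x) :
    0 ≤ erlangPDF lam i x := by
  unfold erlangPDF; positivity

/-- The derivatives of consecutive Poisson weights telescope, leaving the Erlang density.
Integrated, this says that the `(i + 1)`-st point comes by time `z` exactly when there are at least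
`i + 1` points by then. -/
lemma hasDerivAt_sum_poissonWeight (lam : ℝ) (i : ℕ) (x : ℝ) :
    HasDerivAt (fun x => -∑ k ∈ Finset.range (i + 1), poissonWeight lam k x)
      (erlangPDF lam i x) x := by
  have hexp : HasDerivAt (fun x : ℝ => Real.exp (-(lam * x))) (Real.exp (-(lam * x)) * -lam) x := by
    simpa using (((hasDerivAt_id x).const_mul lam).neg).exp
  induction i with
  | zero =>
    simp only [zero_add, Finset.sum_range_one, poissonWeight, erlangPDF, pow_zero, Nat.factorial_zero,
      Nat.cast_one, mul_one, div_one, pow_one]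
    convert! hexp.neg using 1
    ring
  | succ i ih =>
    have hp : HasDerivAt (fun x : ℝ => (lam * x) ^ (i + 1))
        ((i + 1 : ℕ) * (lam * x) ^ i * lam) x := by
      simpa using ((hasDerivAt_id x).const_mul lam).fun_pow (i + 1)
    have h1 := ih.sub ((hexp.mul hp).div_const ((i + 1).factorial : ℝ))
    have hfun : (fun x => -∑ k ∈ Finset.range (i + 1 + 1), poissonWeight lam k x)
        = (fun x => -∑ k ∈ Finset.range (i + 1), poissonWeight lam k x) -
          fun x => Real.exp (-(lam * x)) * (lam * x) ^ (i + 1) / ((i + 1).factorial : ℝ) := by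
      funext x
      rw [Finset.sum_range_succ]
      simp only [Pi.sub_apply, poissonWeight]
      ring
    rw [hfun]
    refine h1.congr_deriv ?_
    simp only [erlangPDF, Nat.factorial_succ, Nat.cast_mul, Nat.cast_succ, mul_pow]
    have h2 : ((i.factorial : ℕ) : ℝ) ≠ 0 := by positivity
    have h3 : ((i : ℝ) + 1) ≠ 0 := by positivity
    field_simp
    ring

lemma sum_poissonWeight_zero (lam : ℝ) (i : ℕ) :
    ∑ k ∈ Finset.range (i + 1), poissonWeight lam k 0 = 1 := by
  rw [Finset.sum_eq_single 0] <;> simp +contextual [poissonWeight]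

lemma lintegral_erlangPDF_Ioc {lam : ℝ} (hlam : 0 ≤ lam) (i : ℕ) {z : ℝ} (hz : 0 ≤ z) :
    ∫⁻ x in Set.Ioc 0 z, ENNReal.ofReal (erlangPDF lam i x)
      = ENNReal.ofReal (1 - ∑ k ∈ Finset.range (i + 1), poissonWeight lam k z) := by
  have h1 : ∫ x in (0 : ℝ)..z, erlangPDF lam i x
      = 1 - ∑ k ∈ Finset.range (i + 1), poissonWeight lam k z := by
    rw [intervalIntegral.integral_eq_sub_of_hasDerivAt
      (fun x _ => hasDerivAt_sum_poissonWeight lam i x)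
      ((continuous_erlangPDF lam i).intervalIntegrable _ _), sum_poissonWeight_zero]
    ring
  rw [← h1, intervalIntegral.integral_of_le hz, ofReal_integral_eq_lintegral_ofReal]
  · exact ((continuous_erlangPDF lam i).integrableOn_Icc).mono_set Set.Ioc_subset_Icc_self
  · filter_upwards [ae_restrict_mem measurableSet_Ioc] with x hx
    exact erlangPDF_nonneg hlam i hx.1.le

lemma hasSum_poissonWeight (lam x : ℝ) : HasSum (fun m => poissonWeight lam m x) 1 := by
  have h := (NormedSpace.expSeries_div_hasSum_exp (lam * x)).mul_left (Real.exp (-(lam * x)))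
  rw [← Real.exp_eq_exp_ℝ, ← Real.exp_add, neg_add_cancel, Real.exp_zero] at h
  exact h.congr_fun fun m => mul_div_assoc _ _ _

lemma lintegral_erlangPDF_Ioc_eq_tsum {lam : ℝ} (hlam : 0 ≤ lam) (i : ℕ) {z : ℝ} (hz : 0 ≤ z) :
    ∫⁻ x in Set.Ioc 0 z, ENNReal.ofReal (erlangPDF lam i x)
      = ∑' k, ENNReal.ofReal (poissonWeight lam (i + 1 + k) z) := by
  have h := hasSum_poissonWeight lam z
  rw [lintegral_erlangPDF_Ioc hlam i hz, ← h.tsum_eq,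
    ← h.summable.sum_add_tsum_nat_add (i + 1), add_sub_cancel_left]
  simp only [add_comm _ (i + 1)]
  refine ENNReal.ofReal_tsum_of_nonneg (fun k => poissonWeight_nonneg hlam _ hz) ?_
  simpa only [add_comm _ (i + 1)] using (summable_nat_add_iff (i + 1)).2 h.summable

/-- The tail of a mixed Poisson law in terms of the survival function of the mixing law. -/
lemma tsum_mixedPoisson {lam : ℝ} (hlam : 0 ≤ lam) (Q : Measure ℝ) [IsFiniteMeasure Q] (i : ℕ) :
    ∑' k, ENNReal.ofReal (mixedPoisson lam Q (i + 1 + k)) = erlangMean lam i (surv Q) := by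
  have hm : Measurable fun x => ENNReal.ofReal (erlangPDF lam i x) :=
    (measurable_erlangPDF lam i).ennreal_ofReal
  simp only [ofReal_mixedPoisson hlam]
  rw [← lintegral_tsum fun k => (measurable_poissonWeight lam _).ennreal_ofReal.aemeasurable]
  -- Tonelli on the region where the Erlang time is less than the mixing variable.
  have hset : MeasurableSet {p : ℝ × ℝ | p.2 < p.1} := measurableSet_lt measurable_snd measurable_fst
  have h1 : ∀ z ∈ Set.Ici (0 : ℝ), ∑' k, ENNReal.ofReal (poissonWeight lam (i + 1 + k) z)
      = ∫⁻ x in Set.Ioi 0, {p : ℝ × ℝ | p.2 < p.1}.indicator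
          (fun p => ENNReal.ofReal (erlangPDF lam i p.2)) (z, x) := by
    intro z hz
    rw [← lintegral_erlangPDF_Ioc_eq_tsum hlam i hz, ← Measure.restrict_congr_set Ioo_ae_eq_Ioc,
      ← lintegral_indicator measurableSet_Ioo, ← lintegral_indicator measurableSet_Ioi]
    refine lintegral_congr fun x => ?_
    simp only [Set.indicator_apply, Set.mem_Ioo, Set.mem_Ioi, Set.mem_ofPred_eq]
    split_ifs <;> first | rfl | tauto
  rw [setLIntegral_congr_fun measurableSet_Ici h1, lintegral_lintegral_swap
    (f := fun z x => {p : ℝ × ℝ | p.2 < p.1}.indicator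
      (fun p => ENNReal.ofReal (erlangPDF lam i p.2)) (z, x))
    (Measurable.aemeasurable ((hm.comp measurable_snd).indicator hset))]
  refine setLIntegral_congr_fun measurableSet_Ioi fun x hx => ?_
  have h2 : ∀ z, {p : ℝ × ℝ | p.2 < p.1}.indicator
      (fun p => ENNReal.ofReal (erlangPDF lam i p.2)) (z, x)
      = (Set.Ioi x).indicator (fun _ => ENNReal.ofReal (erlangPDF lam i x)) z := fun z => by
    simp [Set.indicator_apply]
  simp only [h2]
  rw [lintegral_indicator_const measurableSet_Ioi, Measure.restrict_apply measurableSet_Ioi, surv,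
    Set.inter_eq_left.2]
  exact fun z hz => (Set.mem_Ioi.1 hx).le.trans (Set.mem_Ioi.1 hz).le

/-- Tonelli's theorem for a convolution on the half-line. -/
lemma lintegral_convolution {f g φ : ℝ → ℝ≥0∞} (hf : Measurable f) (hg : Measurable g)
    (hφ : Measurable φ) :
    ∫⁻ u in Set.Ioi 0, f u * ∫⁻ x in Set.Ioi 0, g x * φ (x + u)
      = ∫⁻ z in Set.Ioi 0, (∫⁻ u in Set.Ioc 0 z, f u * g (z - u)) * φ z := by
  set F := (Set.Ioi (0 : ℝ)).indicator f with hF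
  set G := (Set.Ioi (0 : ℝ)).indicator g with hG
  have hFm : Measurable F := hf.indicator measurableSet_Ioi
  have hGm : Measurable G := hg.indicator measurableSet_Ioi
  have h1 : ∀ u, ∫⁻ x in Set.Ioi 0, g x * φ (x + u) = ∫⁻ z, G (z - u) * φ z := by
    intro u
    rw [← lintegral_add_right_eq_self (μ := volume) _ u, ← lintegral_indicator measurableSet_Ioi]
    refine lintegral_congr fun x => ?_
    simp only [hG, Set.indicator_apply, add_sub_cancel_right]
    split_ifs <;> simp
  have h2 : ∀ z, ∫⁻ u, F u * G (z - u) = ∫⁻ u in Set.Ioc 0 z, f u * g (z - u) := by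
    intro z
    rw [← Measure.restrict_congr_set Ioo_ae_eq_Ioc, ← lintegral_indicator measurableSet_Ioo]
    refine lintegral_congr fun u => ?_
    simp only [hF, hG, Set.indicator_apply, Set.mem_Ioi, Set.mem_Ioo, sub_pos]
    split_ifs <;> simp_all
  simp only [h1]
  calc ∫⁻ u in Set.Ioi 0, f u * ∫⁻ z, G (z - u) * φ z
      = ∫⁻ u, F u * ∫⁻ z, G (z - u) * φ z := by
        rw [← lintegral_indicator measurableSet_Ioi]
        refine lintegral_congr fun u => ?_
        simp only [hF, Set.indicator_apply]
        split_ifs <;> simp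
    _ = ∫⁻ u, ∫⁻ z, F u * (G (z - u) * φ z) := by
        refine lintegral_congr fun u => ?_
        rw [lintegral_const_mul]
        exact (hGm.comp (measurable_id.sub_const u)).mul hφ
    _ = ∫⁻ z, ∫⁻ u, F u * (G (z - u) * φ z) := by
        refine lintegral_lintegral_swap (Measurable.aemeasurable ?_)
        exact (hFm.comp measurable_fst).mul
          ((hGm.comp (measurable_snd.sub measurable_fst)).mul (hφ.comp measurable_snd))
    _ = ∫⁻ z, (∫⁻ u in Set.Ioc 0 z, f u * g (z - u)) * φ z := by
        refine lintegral_congr fun z => ?_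
        rw [← h2, ← lintegral_mul_const]
        · exact lintegral_congr fun u => by ring
        · exact hFm.mul (hGm.comp (measurable_const.sub measurable_id))
    _ = _ := by
        rw [← lintegral_indicator measurableSet_Ioi]
        refine lintegral_congr fun z => ?_
        simp only [Set.indicator_apply, Set.mem_Ioi]
        split_ifs with hz
        · rfl
        · rw [Set.Ioc_eq_empty (by simpa using hz)]
          simp

lemma measurable_erlangMean_shift (lam : ℝ) (i : ℕ) {φ : ℝ → ℝ≥0∞} (hφ : Measurable φ) :
    Measurable fun y => erlangMean lam i fun x => φ (x + y) := by
  unfold erlangMean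
  refine Measurable.lintegral_prod_right ?_
  exact ((measurable_erlangPDF lam i).ennreal_ofReal.comp measurable_snd).mul
    (hφ.comp (measurable_snd.add measurable_fst))

lemma erlangMean_succ {lam : ℝ} (hlam : 0 ≤ lam) (m : ℕ) {φ : ℝ → ℝ≥0∞} (hφ : Measurable φ) :
    erlangMean lam (m + 1) φ = erlangMean lam m fun y => erlangMean lam 0 fun x => φ (x + y) := by
  unfold erlangMean
  rw [lintegral_convolution (measurable_erlangPDF lam m).ennreal_ofReal
    (measurable_erlangPDF lam 0).ennreal_ofReal hφ]
  refine setLIntegral_congr_fun measurableSet_Ioi fun z hz => ?_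
  have hz' : 0 ≤ z := (Set.mem_Ioi.1 hz).le
  congr 1
  -- The exponentials multiply to `exp (-lam z)`, so the convolution integral reduces to that of `u
  -- ^ m`.
  have h1 : ∀ u ∈ Set.Ioc 0 z, ENNReal.ofReal (erlangPDF lam m u)
      * ENNReal.ofReal (erlangPDF lam 0 (z - u))
      = ENNReal.ofReal (lam ^ (m + 2) / (m.factorial : ℝ) * Real.exp (-(lam * z)) * u ^ m) := by
    intro u hu
    rw [← ENNReal.ofReal_mul (erlangPDF_nonneg hlam m hu.1.le)]
    congr 1
    have : Real.exp (-(lam * z)) = Real.exp (-(lam * u)) * Real.exp (-(lam * (z - u))) := by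
      rw [← Real.exp_add]; congr 1; ring
    rw [this]
    simp only [erlangPDF, zero_add, pow_one, pow_zero, Nat.factorial_zero, Nat.cast_one]
    ring
  rw [setLIntegral_congr_fun measurableSet_Ioc h1, ← ofReal_integral_eq_lintegral_ofReal]
  · congr 1
    rw [← intervalIntegral.integral_of_le hz', intervalIntegral.integral_const_mul, integral_pow]
    simp only [erlangPDF, Nat.factorial_succ, Nat.cast_mul, Nat.cast_succ]
    have h2 : ((m.factorial : ℕ) : ℝ) ≠ 0 := by positivity
    have h3 : ((m : ℝ) + 1) ≠ 0 := by positivity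
    field_simp
    simp
  · exact (Continuous.integrableOn_Icc (by fun_prop)).mono_set Set.Ioc_subset_Icc_self
  · filter_upwards [ae_restrict_mem measurableSet_Ioc] with u hu
    have := hu.1.le
    simp only [Pi.zero_apply]
    positivity

/-- The sum of independent Erlang variables is an Erlang variable. -/
lemma erlangMean_add {lam : ℝ} (hlam : 0 ≤ lam) (m i : ℕ) {φ : ℝ → ℝ≥0∞} (hφ : Measurable φ) :
    erlangMean lam (m + 1 + i) φ
      = erlangMean lam m fun y => erlangMean lam i fun x => φ (x + y) := by
  induction i generalizing φ with
  | zero => exact erlangMean_succ hlam m hφ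
  | succ i ih =>
    have hS := measurable_erlangMean_shift lam 0 hφ
    rw [← add_assoc, erlangMean_succ hlam _ hφ, ih hS]
    congr 1
    funext y
    rw [erlangMean_succ hlam i (φ := fun x => φ (x + y)) (hφ.comp (measurable_add_const y))]
    simp only [add_assoc]

lemma erlangMean_mono (lam : ℝ) (i : ℕ) {φ ψ : ℝ → ℝ≥0∞} (h : ∀ x, 0 < x → φ x ≤ ψ x) :
    erlangMean lam i φ ≤ erlangMean lam i ψ :=
  setLIntegral_mono' measurableSet_Ioi fun x hx => mul_le_mul_right (h x hx) _

lemma erlangMean_congr (lam : ℝ) (i : ℕ) {φ ψ : ℝ → ℝ≥0∞} (h : ∀ x, 0 < x → φ x = ψ x) :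
    erlangMean lam i φ = erlangMean lam i ψ :=
  setLIntegral_congr_fun measurableSet_Ioi fun x hx => by rw [h x hx]

lemma erlangMean_const_mul (lam : ℝ) (i : ℕ) (c : ℝ≥0∞) {φ : ℝ → ℝ≥0∞} (hφ : Measurable φ) :
    erlangMean lam i (fun x => c * φ x) = c * erlangMean lam i φ := by
  unfold erlangMean
  rw [← lintegral_const_mul]
  · exact lintegral_congr fun x => by ring
  · exact (measurable_erlangPDF lam i).ennreal_ofReal.mul hφ

lemma erlangMean_add_fun (lam : ℝ) (i : ℕ) {φ : ℝ → ℝ≥0∞} (hφ : Measurable φ) (ψ : ℝ → ℝ≥0∞) :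
    erlangMean lam i (fun x => φ x + ψ x) = erlangMean lam i φ + erlangMean lam i ψ := by
  unfold erlangMean
  rw [← lintegral_add_left]
  · exact lintegral_congr fun x => by ring
  · exact (measurable_erlangPDF lam i).ennreal_ofReal.mul hφ

lemma integrableOn_exp_mul_pow {lam : ℝ} (hlam : 0 < lam) (i : ℕ) :
    IntegrableOn (fun x => Real.exp (-(lam * x)) * x ^ i) (Set.Ioi 0) := by
  have h := integrableOn_rpow_mul_exp_neg_mul_rpow (p := 1) (s := i) (b := lam)
    (by have : (0 : ℝ) ≤ i := i.cast_nonneg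
        linarith) one_pos hlam
  refine h.congr_fun (fun x _ => ?_) measurableSet_Ioi
  simp only [Real.rpow_natCast, Real.rpow_one, neg_mul]
  ring

lemma surv_eq_ofReal (Q : Measure ℝ) [IsProbabilityMeasure Q] (x : ℝ) :
    surv Q x = ENNReal.ofReal (1 - cdf Q x) := by
  rw [surv, ← Set.compl_Iic, prob_compl_eq_one_sub measurableSet_Iic, ← ofReal_cdf,
    ENNReal.ofReal_sub _ (cdf_nonneg Q x), ENNReal.ofReal_one]

/-- The order `CLe` in terms of the survival functions. -/
lemma CLe.erlangMean_le {lam : ℝ} (hlam : 0 < lam) {G Q : Measure ℝ} [IsProbabilityMeasure G]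
    [IsProbabilityMeasure Q] (h : CLe lam G Q) (i : ℕ) :
    erlangMean lam i (surv G) ≤ erlangMean lam i (surv Q) := by
  have hc : 0 < lam ^ (i + 1) / (i.factorial : ℝ) := by positivity
  have hint : ∀ (R : Measure ℝ), IntegrableOn
      (fun x => Real.exp (-(lam * x)) * x ^ i * cdf R x) (Set.Ioi 0) := by
    intro R
    refine (integrableOn_exp_mul_pow hlam i).mul_bdd (c := 1)
      (monotone_cdf R).measurable.aestronglyMeasurable (Filter.Eventually.of_forall fun x => ?_)
    rw [Real.norm_of_nonneg (cdf_nonneg R x)]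
    exact cdf_le_one R x
  have key : ∀ (R : Measure ℝ) [IsProbabilityMeasure R], erlangMean lam i (surv R)
      = ENNReal.ofReal (lam ^ (i + 1) / (i.factorial : ℝ) *
        ((∫ x in Set.Ioi 0, Real.exp (-(lam * x)) * x ^ i)
          - ∫ x in Set.Ioi 0, Real.exp (-(lam * x)) * x ^ i * cdf R x)) := by
    intro R _
    rw [← integral_sub (integrableOn_exp_mul_pow hlam i) (hint R), ← integral_const_mul,
      ofReal_integral_eq_lintegral_ofReal]
    · refine setLIntegral_congr_fun measurableSet_Ioi fun x hx => ?_
      rw [surv_eq_ofReal, ← ENNReal.ofReal_mul (erlangPDF_nonneg hlam.le i (Set.mem_Ioi.1 hx).le)]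
      congr 1
      simp only [erlangPDF]
      ring
    · exact ((integrableOn_exp_mul_pow hlam i).sub (hint R)).const_mul _
    · filter_upwards [ae_restrict_mem measurableSet_Ioi] with x hx
      have h1 := cdf_le_one R x
      have h2 : 0 ≤ Real.exp (-(lam * x)) * x ^ i :=
        mul_nonneg (Real.exp_pos _).le (pow_nonneg (Set.mem_Ioi.1 hx).le _)
      have h3 : Real.exp (-(lam * x)) * x ^ i * cdf R x ≤ Real.exp (-(lam * x)) * x ^ i := by
        nlinarith
      exact mul_nonneg hc.le (by linarith)
  rw [key, key]
  exact ENNReal.ofReal_le_ofReal (mul_le_mul_of_nonneg_left (by linarith [h i]) hc.le)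

lemma isProbabilityMeasure_residualLaw {F : Measure ℝ} [IsFiniteMeasure F] {y : ℝ}
    (hy : F (Set.Ioi y) ≠ 0) : IsProbabilityMeasure (residualLaw F y) := by
  have := cond_isProbabilityMeasure hy
  exact Measure.isProbabilityMeasure_map (measurable_id.sub_const y).aemeasurable

/-- Multiplication rule for outliving the age `y` and then a further time `x`. If `F` has no mass
beyond `y`, both sides vanish, whatever value the residual law takes there. -/
lemma surv_add {F : Measure ℝ} [IsFiniteMeasure F] {x y : ℝ} (hx : 0 ≤ x) :
    surv F (x + y) = surv F y * surv (residualLaw F y) x := by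
  have h1 : (fun t => t - y) ⁻¹' Set.Ioi x = Set.Ioi (x + y) := by
    ext t; simp
  have h2 : Set.Ioi (x + y) ⊆ Set.Ioi y := Set.Ioi_subset_Ioi (by linarith)
  by_cases hy : F (Set.Ioi y) = 0
  · rw [surv, surv, hy, zero_mul]
    exact measure_mono_null h2 hy
  · rw [surv, surv, surv, residualLaw,
      Measure.map_apply (measurable_sub_const' y) measurableSet_Ioi, h1,
      cond_apply measurableSet_Ioi, Set.inter_eq_right.2 h2, ← mul_assoc,
      ENNReal.mul_inv_cancel hy (measure_ne_top _ _), one_mul]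

/-- The survival function of the exponential law on `[0, ∞)`. -/
noncomputable def expSurv (μ : ℝ) (x : ℝ) : ℝ≥0∞ := ENNReal.ofReal (Real.exp (-(μ * x)))

lemma measurable_expSurv (μ : ℝ) : Measurable (expSurv μ) := by
  unfold expSurv; fun_prop

lemma surv_expMeasure {μ : ℝ} (hμ : 0 < μ) {x : ℝ} (hx : 0 ≤ x) :
    surv (expMeasure μ) x = expSurv μ x := by
  have := isProbabilityMeasure_expMeasure hμ
  rw [surv_eq_ofReal, cdf_expMeasure_eq hμ, if_pos hx, sub_sub_cancel, expSurv]

/-- Lack of memory: for an exponential service the inequality of `ConditionD.erlangMean_mul_le`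
becomes an equality. -/
lemma erlangMean_expSurv_add {lam : ℝ} (hlam : 0 ≤ lam) (μ : ℝ) (m i : ℕ) :
    erlangMean lam (m + 1 + i) (expSurv μ)
      = erlangMean lam m (expSurv μ) * erlangMean lam i (expSurv μ) := by
  rw [erlangMean_add hlam m i (measurable_expSurv μ), mul_comm,
    ← erlangMean_const_mul _ _ _ (measurable_expSurv μ)]
  congr 1
  funext y
  rw [mul_comm, ← erlangMean_const_mul _ _ _ (measurable_expSurv μ)]
  congr 1
  funext x
  rw [expSurv, expSurv, expSurv, ← ENNReal.ofReal_mul (Real.exp_pos _).le, ← Real.exp_add]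
  congr 2
  ring

lemma erlangMean_expSurv_zero {lam μ : ℝ} (hlam : 0 < lam) (hμ : 0 ≤ μ) :
    erlangMean lam 0 (expSurv μ) = ENNReal.ofReal (lam / (lam + μ)) := by
  have hs : 0 < lam + μ := by linarith
  have h1 : ∫ x in Set.Ioi (0 : ℝ), lam * Real.exp (-(lam + μ) * x) = lam / (lam + μ) := by
    rw [integral_const_mul, integral_exp_mul_Ioi (by linarith)]
    simp only [mul_zero, Real.exp_zero]
    field_simp
  rw [← h1, ofReal_integral_eq_lintegral_ofReal]
  · refine setLIntegral_congr_fun measurableSet_Ioi fun x hx => ?_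
    simp only [expSurv]
    rw [← ENNReal.ofReal_mul (erlangPDF_nonneg hlam.le 0 (Set.mem_Ioi.1 hx).le)]
    congr 1
    simp only [erlangPDF, zero_add, pow_one, pow_zero, Nat.factorial_zero, Nat.cast_one, mul_one,
      div_one]
    rw [mul_assoc, ← Real.exp_add]
    congr 2
    ring
  · exact (exp_neg_integrableOn_Ioi 0 hs).const_mul lam
  · exact Filter.Eventually.of_forall fun x => by positivity

lemma erlangMean_const {lam : ℝ} (hlam : 0 < lam) (c : ℝ≥0∞) :
    erlangMean lam 0 (fun _ => c) = c := by
  have h := erlangMean_expSurv_zero hlam le_rfl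
  rw [add_zero, div_self hlam.ne', ENNReal.ofReal_one] at h
  have h1 : expSurv 0 = fun _ => 1 := by funext x; simp [expSurv]
  rw [h1] at h
  simpa [h] using erlangMean_const_mul lam 0 c (φ := fun _ => 1) measurable_const

lemma tsum_mixedPoisson_zero {lam : ℝ} (hlam : 0 ≤ lam) (Q : Measure ℝ) [IsProbabilityMeasure Q]
    (hQ : Q (Set.Iio 0) = 0) : ∑' k, ENNReal.ofReal (mixedPoisson lam Q k) = 1 := by
  simp only [ofReal_mixedPoisson hlam]
  rw [← lintegral_tsum fun k => (measurable_poissonWeight lam _).ennreal_ofReal.aemeasurable]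
  have h1 : ∀ z ∈ Set.Ici (0 : ℝ), ∑' k, ENNReal.ofReal (poissonWeight lam k z) = 1 := by
    intro z hz
    rw [← ENNReal.ofReal_tsum_of_nonneg (fun k => poissonWeight_nonneg hlam k hz)
      (hasSum_poissonWeight lam z).summable, (hasSum_poissonWeight lam z).tsum_eq, ENNReal.ofReal_one]
  rw [setLIntegral_congr_fun measurableSet_Ici h1, setLIntegral_one, ← Set.compl_Iio,
    prob_compl_eq_one_sub measurableSet_Iio, hQ, tsub_zero]

lemma ofReal_mixedPoisson_zero_add {lam : ℝ} (hlam : 0 ≤ lam) (Q : Measure ℝ)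
    [IsProbabilityMeasure Q] (hQ : Q (Set.Iio 0) = 0) :
    ENNReal.ofReal (mixedPoisson lam Q 0) + erlangMean lam 0 (surv Q) = 1 := by
  have h := tsum_mixedPoisson_zero hlam Q hQ
  rw [tsum_eq_zero_add' ENNReal.summable] at h
  rw [← tsum_mixedPoisson hlam Q 0]
  simpa only [zero_add, add_comm 1] using h

lemma mixedPoisson_zero_eq_laplace (lam : ℝ) (Q : Measure ℝ) :
    mixedPoisson lam Q 0 = laplace Q lam := by
  simp [mixedPoisson, laplace]

lemma laplace_nonneg (lam : ℝ) (Q : Measure ℝ) : 0 ≤ laplace Q lam :=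
  integral_nonneg fun _ => (Real.exp_pos _).le

lemma laplace_add_erlangMean {lam : ℝ} (hlam : 0 ≤ lam) (Q : Measure ℝ)
    [IsProbabilityMeasure Q] (hQ : Q (Set.Iio 0) = 0) :
    laplace Q lam + (erlangMean lam 0 (surv Q)).toReal = 1 := by
  have h := ofReal_mixedPoisson_zero_add hlam Q hQ
  rw [mixedPoisson_zero_eq_laplace] at h
  have hne : erlangMean lam 0 (surv Q) ≠ ⊤ :=
    ne_top_of_le_ne_top ENNReal.one_ne_top (h ▸ le_add_self)
  have := congrArg ENNReal.toReal h
  rwa [ENNReal.toReal_add ENNReal.ofReal_ne_top hne, ENNReal.toReal_ofReal (laplace_nonneg _ _),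
    ENNReal.toReal_one] at this

/-- The layer-cake formula for the mean. -/
lemma ConditionA.lintegral_surv {μ ε : ℝ} {B F : Measure ℝ} (hA : ConditionA (1 / 2) μ ε B F) :
    ∫⁻ y in Set.Ioi 0, surv F y = ENNReal.ofReal (1 / μ) := by
  have h0 : 0 ≤ᵐ[F] fun x : ℝ => x := by
    have : F {x | ¬ 0 ≤ x} = 0 := by
      refine measure_mono_null (fun x (hx : ¬ 0 ≤ x) => ?_) hA.nonneg
      exact not_le.1 hx
    exact ae_iff.2 this
  rw [← hA.mean, ofReal_integral_eq_lintegral_ofReal hA.integrable h0,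
    lintegral_eq_lintegral_meas_lt F h0 measurable_id.aemeasurable]
  rfl

/-! ### Consequences of conditions (A) and (D) -/

section Conditions

variable {lam μ ε y₀ : ℝ} {B F : Measure ℝ} [IsProbabilityMeasure B] [IsProbabilityMeasure F]

/-- The age of the service adds to the residual service time at least in the sense of the
least residual law. -/
lemma ConditionD.erlangMean_mul_le (hD : ConditionD lam F y₀) (hlam : 0 < lam) (m i : ℕ) :
    erlangMean lam m (surv F) * erlangMean lam i (surv (residualLaw F y₀))
      ≤ erlangMean lam (m + 1 + i) (surv F) := by
  have := isProbabilityMeasure_residualLaw hD.defined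
  rw [erlangMean_add hlam.le m i (measurable_surv F), mul_comm,
    ← erlangMean_const_mul _ _ _ (measurable_surv F)]
  refine erlangMean_mono lam m fun y hy => ?_
  have h1 : erlangMean lam i (fun x => surv F (x + y))
      = surv F y * erlangMean lam i (surv (residualLaw F y)) := by
    rw [← erlangMean_const_mul _ _ _ (measurable_surv _)]
    exact erlangMean_congr lam i fun x hx => surv_add hx.le
  rw [h1, mul_comm]
  by_cases hy0 : F (Set.Ioi y) = 0
  · simp [surv, hy0]
  · have := isProbabilityMeasure_residualLaw hy0
    exact mul_le_mul_right ((hD.least y hy.le hy0).erlangMean_le hlam i) _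

lemma surv_residualLaw_zero (hF : F (Set.Ioi 0) = 1) {x : ℝ} (hx : 0 ≤ x) :
    surv (residualLaw F 0) x = surv F x := by
  have h := surv_add (F := F) (y := 0) hx
  rw [add_zero, surv, surv, hF, one_mul] at h
  exact h.symm

/-- With no mass at `0`, `F` is its own residual law at age `0`, hence a member of the family in
(D). -/
lemma ConditionD.erlangMean_le (hD : ConditionD lam F y₀) (hlam : 0 < lam)
    (hF : F (Set.Ioi 0) = 1) (i : ℕ) :
    erlangMean lam i (surv (residualLaw F y₀)) ≤ erlangMean lam i (surv F) := by
  have h0 : F (Set.Ioi 0) ≠ 0 := by simp [hF]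
  have := isProbabilityMeasure_residualLaw hD.defined
  have := isProbabilityMeasure_residualLaw h0
  rw [← erlangMean_congr lam i fun x hx => surv_residualLaw_zero hF hx.le]
  exact (hD.least 0 le_rfl h0).erlangMean_le hlam i

/-- At `x = 0` the mixture equation and `B(0) = 0` leave no atom of `F` at `0`. -/
lemma ConditionA.measure_Ioi (hA : ConditionA (1 / 2) μ ε B F) : F (Set.Ioi 0) = 1 := by
  have h := hA.mixture 0 le_rfl
  have hB : cdf B 0 = 0 := by
    rw [cdf_eq_real, measureReal_def, hA.service_pos, ENNReal.toReal_zero]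
  have h1 : cdf F 0 = 0 := by
    rw [hB] at h
    simp at h
    linarith
  have := surv_eq_ofReal F 0
  rwa [h1, sub_zero, ENNReal.ofReal_one] at this

lemma ConditionA.erlangMean_service (hA : ConditionA (1 / 2) μ ε B F) (i : ℕ) :
    erlangMean lam i (surv B)
      = 2⁻¹ * erlangMean lam i (surv F) + 2⁻¹ * erlangMean lam i (expSurv μ) := by
  rw [← erlangMean_const_mul _ _ _ (measurable_surv F),
    ← erlangMean_const_mul _ _ _ (measurable_expSurv μ),
    ← erlangMean_add_fun _ _ ((measurable_surv F).const_mul _)]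
  refine erlangMean_congr lam i fun x hx => ?_
  have h2 : (2⁻¹ : ℝ≥0∞) = ENNReal.ofReal (1 / 2) := by
    rw [one_div, ENNReal.ofReal_inv_of_pos two_pos, ENNReal.ofReal_ofNat]
  rw [surv_eq_ofReal, surv_eq_ofReal, expSurv, h2, ← ENNReal.ofReal_mul (by norm_num),
    ← ENNReal.ofReal_mul (by norm_num), ← ENNReal.ofReal_add, hA.mixture x hx.le]
  · congr 1; ring
  · have := cdf_le_one F x
    linarith
  · positivity

/-- Both components of the service law have residual laws above `c`. -/
lemma ConditionA.mul_tail_le (hA : ConditionA (1 / 2) μ ε B F) (hD : ConditionD lam F y₀)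
    (hlam : 0 < lam) {c : ℝ≥0∞} {i : ℕ} (h1 : c ≤ erlangMean lam i (surv (residualLaw F y₀)))
    (h2 : c ≤ erlangMean lam i (expSurv μ)) (m : ℕ) :
    c * ∑' k, ENNReal.ofReal (mixedPoisson lam B (m + k))
      ≤ ∑' k, ENNReal.ofReal (mixedPoisson lam B (m + (i + 1) + k)) := by
  rw [show m + (i + 1) = m + i + 1 by ring, tsum_mixedPoisson hlam.le B (m + i),
    hA.erlangMean_service]
  cases m with
  | zero =>
    have hB : B (Set.Iio 0) = 0 := measure_mono_null Set.Iio_subset_Iic_self hA.service_pos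
    simp only [zero_add]
    rw [tsum_mixedPoisson_zero hlam.le B hB, mul_one]
    calc c = 2⁻¹ * c + 2⁻¹ * c := by
          rw [← add_mul, ENNReal.inv_two_add_inv_two, one_mul]
      _ ≤ _ := by
          gcongr
          exact h1.trans (hD.erlangMean_le hlam hA.measure_Ioi i)
  | succ m =>
    rw [tsum_mixedPoisson hlam.le B m, hA.erlangMean_service, erlangMean_expSurv_add hlam.le]
    calc c * (2⁻¹ * erlangMean lam m (surv F) + 2⁻¹ * erlangMean lam m (expSurv μ))
        = 2⁻¹ * (erlangMean lam m (surv F) * c) + 2⁻¹ * (erlangMean lam m (expSurv μ) * c) := by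
          ring
      _ ≤ _ := by
          gcongr
          exact (mul_le_mul_right h1 _).trans (hD.erlangMean_mul_le hlam m i)

lemma ConditionA.residualBound (hA : ConditionA (1 / 2) μ ε B F) (hD : ConditionD lam F y₀)
    (hlam : 0 < lam) (hμ : 0 < μ) {G : Measure ℝ} [IsProbabilityMeasure G]
    (hG : G (Set.Iio 0) = 0) (hG1 : CLe lam G (residualLaw F y₀)) (hG2 : CLe lam G (expMeasure μ)) :
    ResidualBound (fun k => ENNReal.ofReal (mixedPoisson lam B k))
      (fun k => ENNReal.ofReal (mixedPoisson lam G k))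
      (min (erlangMean lam 0 (surv (residualLaw F y₀))) (erlangMean lam 0 (expSurv μ))) where
  tsum_eq_one := tsum_mixedPoisson_zero hlam.le B
    (measure_mono_null Set.Iio_subset_Iic_self hA.service_pos)
  succ m := hA.mul_tail_le hD hlam (min_le_left _ _) (min_le_right _ _) m
  add m i := by
    cases i with
    | zero =>
      simp only [zero_add, add_zero]
      rw [tsum_mixedPoisson_zero hlam.le G hG, mul_one]
    | succ i =>
      have := isProbabilityMeasure_residualLaw hD.defined
      have := isProbabilityMeasure_expMeasure hμ
      rw [mul_comm, tsum_mixedPoisson hlam.le G i]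
      refine hA.mul_tail_le hD hlam (hG1.erlangMean_le hlam i) ((hG2.erlangMean_le hlam i).trans ?_) m
      exact (erlangMean_congr lam i fun x hx => surv_expMeasure hμ hx.le).le

/-- The supremum in Condition (A) is a bound. -/
lemma ConditionA.exists_bound (hA : ConditionA (1 / 2) μ ε B F) :
    ∃ δ, 0 ≤ δ ∧ δ < ε ∧ ∀ x y : ℝ, 0 ≤ x → 0 ≤ y → F (Set.Ioi y) ≠ 0 →
      |cdf (residualLaw F y) x - cdf F x| ≤ δ := by
  have hbdd : BddAbove {d : ℝ | ∃ x y : ℝ, 0 ≤ x ∧ 0 ≤ y ∧ F (Set.Ioi y) ≠ 0 ∧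
      d = |cdf (residualLaw F y) x - cdf F x|} := by
    refine ⟨1, ?_⟩
    rintro _ ⟨x, y, -, -, -, rfl⟩
    rw [abs_le]
    constructor <;> linarith [cdf_le_one F x, cdf_nonneg F x, cdf_le_one (residualLaw F y) x,
      cdf_nonneg (residualLaw F y) x]
  have hle : ∀ x y : ℝ, 0 ≤ x → 0 ≤ y → F (Set.Ioi y) ≠ 0 →
      |cdf (residualLaw F y) x - cdf F x| ≤ _ :=
    fun x y hx hy h => le_csSup hbdd ⟨x, y, hx, hy, h, rfl⟩
  exact ⟨_, (abs_nonneg _).trans (hle 0 0 le_rfl le_rfl (by simp [hA.measure_Ioi])), hA.close, hle⟩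

/-- A uniform bound survives averaging against a probability density. -/
lemma erlangMean_le_add {δ : ℝ} (hlam : 0 < lam) {Q R : Measure ℝ} [IsProbabilityMeasure Q]
    [IsProbabilityMeasure R] (h : ∀ x, 0 ≤ x → |cdf Q x - cdf R x| ≤ δ) :
    erlangMean lam 0 (surv Q) ≤ erlangMean lam 0 (surv R) + ENNReal.ofReal δ := by
  rw [← erlangMean_const hlam (ENNReal.ofReal δ), ← erlangMean_add_fun _ _ (measurable_surv R)]
  refine erlangMean_mono lam 0 fun x hx => ?_
  have h1 := (abs_le.1 (h x hx.le)).1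
  rw [surv_eq_ofReal, surv_eq_ofReal]
  exact (ENNReal.ofReal_le_ofReal (by linarith)).trans ENNReal.ofReal_add_le

lemma erlangMean_surv_le_one (hlam : 0 < lam) (Q : Measure ℝ) [IsProbabilityMeasure Q] :
    erlangMean lam 0 (surv Q) ≤ 1 := by
  rw [← erlangMean_const hlam 1]
  exact erlangMean_mono lam 0 fun x _ => prob_le_one

/-- The mean residual transform, integrated over the ages. -/
lemma lintegral_surv_mul_erlangMean (hlam : 0 < lam) :
    (∫⁻ y in Set.Ioi 0, surv F y * erlangMean lam 0 (surv (residualLaw F y)))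
        + erlangMean lam 0 (surv F) * ENNReal.ofReal (1 / lam)
      = ∫⁻ y in Set.Ioi 0, surv F y := by
  have he : Measurable fun x => ENNReal.ofReal (erlangPDF lam 0 x) :=
    (measurable_erlangPDF lam 0).ennreal_ofReal
  have h1 : ∫⁻ y in Set.Ioi 0, surv F y * erlangMean lam 0 (surv (residualLaw F y))
      = ∫⁻ y in Set.Ioi 0, ∫⁻ x in Set.Ioi 0, ENNReal.ofReal (erlangPDF lam 0 x) * surv F (x + y) := by
    refine lintegral_congr fun y => ?_
    rw [← erlangMean_const_mul _ _ _ (measurable_surv _)]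
    exact (erlangMean_congr lam 0 fun x hx => surv_add hx.le).symm
  have h2 : ∫⁻ y in Set.Ioi 0, ∫⁻ x in Set.Ioi 0, ENNReal.ofReal (erlangPDF lam 0 x) * surv F (x + y)
      = ∫⁻ z in Set.Ioi 0, ENNReal.ofReal (1 - Real.exp (-(lam * z))) * surv F z := by
    rw [lintegral_lintegral_swap (Measurable.aemeasurable ((he.comp measurable_snd).mul
      ((measurable_surv F).comp (measurable_snd.add measurable_fst))))]
    have h3 := lintegral_convolution he (g := fun _ => 1) measurable_const (measurable_surv F)
    simp only [one_mul, mul_one] at h3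
    calc _ = ∫⁻ x in Set.Ioi 0, ENNReal.ofReal (erlangPDF lam 0 x) *
          ∫⁻ y in Set.Ioi 0, surv F (y + x) := by
          refine lintegral_congr fun x => ?_
          simp only [add_comm x]
          exact lintegral_const_mul _ ((measurable_surv F).comp (measurable_add_const x))
      _ = _ := h3
      _ = _ := by
          refine setLIntegral_congr_fun measurableSet_Ioi fun z hz => ?_
          rw [lintegral_erlangPDF_Ioc hlam.le 0 (Set.mem_Ioi.1 hz).le]
          simp [poissonWeight]
  have h5 := lintegral_mul_const (μ := volume.restrict (Set.Ioi 0)) (ENNReal.ofReal (1 / lam))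
    (f := fun x => ENNReal.ofReal (erlangPDF lam 0 x) * surv F x) (he.mul (measurable_surv F))
  rw [h1, h2, erlangMean, ← h5, ← lintegral_add_left]
  · refine setLIntegral_congr_fun measurableSet_Ioi fun z hz => ?_
    have hz' := (Set.mem_Ioi.1 hz).le
    -- The integrated residual transform weights `surv F z` by the exponential distribution function
    -- at `z`; the density divided by `lam` is exactly its complement.
    have h4 : ENNReal.ofReal (1 - Real.exp (-(lam * z)))
        + ENNReal.ofReal (erlangPDF lam 0 z) * ENNReal.ofReal (1 / lam) = 1 := by
      rw [← ENNReal.ofReal_mul (erlangPDF_nonneg hlam.le 0 hz'), ← ENNReal.ofReal_add,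
        ← ENNReal.ofReal_one]
      · congr 1
        simp only [erlangPDF, zero_add, pow_one, pow_zero, Nat.factorial_zero, Nat.cast_one]
        field_simp
        ring
      · have : Real.exp (-(lam * z)) ≤ 1 := Real.exp_le_one_iff.2 (by nlinarith)
        linarith
      · exact mul_nonneg (erlangPDF_nonneg hlam.le 0 hz') (by positivity)
    calc _ = (ENNReal.ofReal (1 - Real.exp (-(lam * z)))
        + ENNReal.ofReal (erlangPDF lam 0 z) * ENNReal.ofReal (1 / lam)) * surv F z := by
          ring
      _ = _ := by rw [h4, one_mul]
  · exact Measurable.mul (by fun_prop) (measurable_surv F)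

end Conditions

/-- A law whose residual laws are close to it is close to the exponential law with the same mean,
in the sense of the Laplace transform. -/
lemma ConditionA.abs_erlangMean_sub_le {lam μ ε : ℝ} {B F : Measure ℝ} [IsProbabilityMeasure F]
    (hA : ConditionA (1 / 2) μ ε B F) (hlam : 0 < lam)
    (hμ : 0 < μ) {δ : ℝ} (hδ : 0 ≤ δ)
    (h : ∀ x y : ℝ, 0 ≤ x → 0 ≤ y → F (Set.Ioi y) ≠ 0 →
      |cdf (residualLaw F y) x - cdf F x| ≤ δ) :
    |(erlangMean lam 0 (surv F)).toReal - lam / (lam + μ)| ≤ δ := by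
  set a := erlangMean lam 0 (surv F) with ha
  set I := ∫⁻ y in Set.Ioi 0, surv F y * erlangMean lam 0 (surv (residualLaw F y)) with hI
  -- If all residual transforms were equal to `a`, then `I = a / μ`, and this equation would give
  -- the exponential value `a = lam / (lam + μ)`. The bounds `h2` and `h3` allow a deviation `δ` at
  -- each age.
  have h1 : I + a * ENNReal.ofReal (1 / lam) = ENNReal.ofReal (1 / μ) := by
    rw [hI, ha, lintegral_surv_mul_erlangMean hlam, hA.lintegral_surv]
  have h2 : I ≤ ENNReal.ofReal (1 / μ) * (a + ENNReal.ofReal δ) := by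
    rw [← hA.lintegral_surv, ← lintegral_mul_const _ (measurable_surv F)]
    refine setLIntegral_mono' measurableSet_Ioi fun y hy => ?_
    by_cases hy0 : F (Set.Ioi y) = 0
    · simp [surv, hy0]
    · have := isProbabilityMeasure_residualLaw hy0
      exact mul_le_mul_right (erlangMean_le_add hlam fun x hx =>
        h x y hx (Set.mem_Ioi.1 hy).le hy0) _
  have h3 : ENNReal.ofReal (1 / μ) * a ≤ I + ENNReal.ofReal (1 / μ) * ENNReal.ofReal δ := by
    rw [← hA.lintegral_surv, ← lintegral_mul_const _ (measurable_surv F),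
      ← lintegral_mul_const _ (measurable_surv F), hI, ← lintegral_add_right _
      ((measurable_surv F).mul_const _)]
    refine setLIntegral_mono' measurableSet_Ioi fun y hy => ?_
    by_cases hy0 : F (Set.Ioi y) = 0
    · simp [surv, hy0]
    · have := isProbabilityMeasure_residualLaw hy0
      rw [← mul_add]
      exact mul_le_mul_right (erlangMean_le_add hlam fun x hx => by
        rw [abs_sub_comm]; exact h x y hx (Set.mem_Ioi.1 hy).le hy0) _
  have ha1 : a ≠ ⊤ := ne_top_of_le_ne_top ENNReal.one_ne_top (erlangMean_surv_le_one hlam F)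
  have hI1 : I ≠ ⊤ := ne_top_of_le_ne_top ENNReal.ofReal_ne_top (h1 ▸ le_self_add)
  obtain ⟨a', ha', haa⟩ : ∃ a' : ℝ, 0 ≤ a' ∧ a = ENNReal.ofReal a' :=
    ⟨a.toReal, ENNReal.toReal_nonneg, (ENNReal.ofReal_toReal ha1).symm⟩
  obtain ⟨I', hI', hII⟩ : ∃ I' : ℝ, 0 ≤ I' ∧ I = ENNReal.ofReal I' :=
    ⟨I.toReal, ENNReal.toReal_nonneg, (ENNReal.ofReal_toReal hI1).symm⟩
  have hm : 0 < 1 / μ := by positivity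
  have hl : 0 < 1 / lam := by positivity
  rw [haa, hII] at h1 h2 h3
  rw [← ENNReal.ofReal_mul ha', ← ENNReal.ofReal_add hI' (by positivity),
    ENNReal.ofReal_eq_ofReal_iff (by positivity) hm.le] at h1
  rw [← ENNReal.ofReal_add ha' hδ, ← ENNReal.ofReal_mul hm.le,
    ENNReal.ofReal_le_ofReal_iff (by positivity)] at h2
  rw [← ENNReal.ofReal_mul hm.le, ← ENNReal.ofReal_mul hm.le, ← ENNReal.ofReal_add hI' (by positivity),
    ENNReal.ofReal_le_ofReal_iff (by positivity)] at h3
  rw [haa, ENNReal.toReal_ofReal ha']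
  have hs : 0 < lam + μ := by linarith
  have hu : a' * (lam + μ) ≤ lam + δ * lam := by
    have : (1 / μ * a' + a' * (1 / lam)) * (lam * μ) ≤ (1 / μ + 1 / μ * δ) * (lam * μ) :=
      mul_le_mul_of_nonneg_right (by linarith) (by positivity)
    field_simp at this
    linarith
  have hd : lam ≤ a' * (lam + μ) + δ * lam := by
    have : 1 / μ * (lam * μ) ≤ (1 / μ * (a' + δ) + a' * (1 / lam)) * (lam * μ) :=
      mul_le_mul_of_nonneg_right (by linarith) (by positivity)
    field_simp at this
    linarith
  -- The bounds obtained are `δ lam / (lam + μ)`, which is weakened to `δ`.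
  have hδμ : 0 ≤ δ * μ := by positivity
  rw [abs_le, neg_le_sub_iff_le_add, sub_le_iff_le_add, div_le_iff₀ hs, ← sub_le_iff_le_add',
    le_div_iff₀ hs]
  constructor <;> nlinarith

/-! ### The offspring law and its generating function -/

/-- The weights of `r δ_0 + (1 - r) (1 + g)`. -/
noncomputable def offspringWeight (r r' : ℝ≥0∞) (g : ℕ → ℝ≥0∞) : ℕ → ℝ≥0∞
  | 0 => r
  | k + 1 => r' * g k

lemma tsum_offspringWeight {r r' : ℝ≥0∞} (hr : r + r' = 1) {g : ℕ → ℝ≥0∞} (hg : ∑' k, g k = 1) :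
    ∑' k, offspringWeight r r' g k = 1 := by
  rw [tsum_eq_zero_add' ENNReal.summable]
  simp only [offspringWeight, ENNReal.tsum_mul_left, hg, mul_one, hr]

lemma tsum_geometric_weight {b b' : ℝ≥0∞} (hb : b + b' = 1) (hb0 : b ≠ 0) :
    ∑' k : ℕ, b' ^ k * b = 1 := by
  have hb1 : b ≤ 1 := hb ▸ le_self_add
  have hb'1 : b' ≠ ⊤ := ne_top_of_le_ne_top ENNReal.one_ne_top (hb ▸ le_add_self)
  have h : 1 - b' = b := by rw [← hb, ENNReal.add_sub_cancel_right hb'1]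
  rw [ENNReal.tsum_mul_right, ENNReal.tsum_geometric, h,
    ENNReal.inv_mul_cancel hb0 (ne_top_of_le_ne_top ENNReal.one_ne_top hb1)]

lemma one_sub_geometric_norm_pos {β t : ℝ} (hβ0 : 0 < β) (hβ1 : β ≤ 1) (ht1 : t ≤ 1) :
    0 < 1 - t + t * β := by nlinarith

/-- Reverse triangle inequality for `1 - z (1 - β)`. -/
lemma le_norm_one_sub_add_mul {𝕜 : Type*} [RCLike 𝕜] {β : ℝ} (hβ1 : β ≤ 1) (z : 𝕜) :
    1 - ‖z‖ + ‖z‖ * β ≤ ‖1 - z + z * (β : 𝕜)‖ := by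
  have h1 : 1 - z + z * (β : 𝕜) = 1 - z * ((1 - β : ℝ) : 𝕜) := by push_cast; ring
  have h2 : ‖z * ((1 - β : ℝ) : 𝕜)‖ = ‖z‖ * (1 - β) := by
    rw [norm_mul, RCLike.norm_ofReal, abs_of_nonneg (by linarith)]
  have h3 := norm_sub_norm_le (1 : 𝕜) (z * ((1 - β : ℝ) : 𝕜))
  rw [norm_one, h2] at h3
  rw [h1]
  linarith

/-- The generating function of a geometric law whose weight at `0` is changed. -/
lemma pgf_sub_eq {𝕜 : Type*} [RCLike 𝕜] {q : PMF ℕ} {ρ β : ℝ} (hβ0 : 0 < β) (hβ1 : β ≤ 1)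
    (h0 : (q 0).toReal = ρ) (hs : ∀ k, (q (k + 1)).toReal = (1 - ρ) * ((1 - β) ^ k * β)) {z : 𝕜}
    (hz : ‖z‖ ≤ 1) :
    pgf q z - (β : 𝕜) / (1 - z + z * β) = ((ρ - β : ℝ) : 𝕜) * ((1 - z) / (1 - z + z * β)) := by
  have hD : 1 - z + z * (β : 𝕜) ≠ 0 := norm_pos_iff.1
    ((one_sub_geometric_norm_pos hβ0 hβ1 hz).trans_le (le_norm_one_sub_add_mul hβ1 z))
  have hw : ‖((1 - β : ℝ) : 𝕜) * z‖ < 1 := by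
    rw [norm_mul, RCLike.norm_ofReal, abs_of_nonneg (by linarith)]
    nlinarith [norm_nonneg z]
  have hgeo := (hasSum_geometric_of_norm_lt_one hw).mul_left (((1 - ρ) * β : ℝ) * z : 𝕜)
  have hsucc : HasSum (fun m => (((q (m + 1)).toReal : ℝ) : 𝕜) * z ^ (m + 1))
      ((((1 - ρ) * β : ℝ) * z : 𝕜) * (1 - ((1 - β : ℝ) : 𝕜) * z)⁻¹) := by
    refine hgeo.congr_fun fun m => ?_
    rw [hs, mul_pow]
    push_cast
    ring
  have hval : pgf q z = ρ + (((1 - ρ) * β : ℝ) * z : 𝕜) * (1 - ((1 - β : ℝ) : 𝕜) * z)⁻¹ := by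
    rw [pgf, tsum_eq_zero_add' (f := fun m => (((q m).toReal : ℝ) : 𝕜) * z ^ m) hsucc.summable,
      hsucc.tsum_eq, h0]
    simp
  have hD' : 1 - ((1 - β : ℝ) : 𝕜) * z = 1 - z + z * (β : 𝕜) := by push_cast; ring
  rw [hval, hD']
  field_simp
  push_cast
  ring

lemma norm_pgf_sub_lt {𝕜 : Type*} [RCLike 𝕜] {q : PMF ℕ} {ρ β ε : ℝ} (hβ0 : 0 < β) (hβ1 : β ≤ 1)
    (hε : |ρ - β| < 2 * ε)
    (h0 : (q 0).toReal = ρ) (hs : ∀ k, (q (k + 1)).toReal = (1 - ρ) * ((1 - β) ^ k * β)) {z : 𝕜}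
    (hz : ‖z‖ ≤ 1) :
    ‖pgf q z - (β : 𝕜) / (1 - z + z * β)‖
      < 2 * ε * ((1 - ‖z‖ + 2 * ‖z‖ * β) / (1 - ‖z‖ + ‖z‖ * β)) := by
  have hpos := one_sub_geometric_norm_pos hβ0 hβ1 hz
  have hle := le_norm_one_sub_add_mul hβ1 z
  have hD : 1 - z + z * (β : 𝕜) ≠ 0 := norm_pos_iff.1 (hpos.trans_le hle)
  have hnz := norm_nonneg z
  rw [pgf_sub_eq hβ0 hβ1 h0 hs hz, norm_mul, RCLike.norm_ofReal]
  -- Bounding the two terms separately produces the numerator `1 - ‖z‖ + 2 ‖z‖ β` of the claim.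
  have h1 : (1 - z) / (1 - z + z * (β : 𝕜)) = 1 - z * β / (1 - z + z * β) := by
    field_simp
    ring
  have h2 : ‖(1 - z) / (1 - z + z * (β : 𝕜))‖
      ≤ (1 - ‖z‖ + 2 * ‖z‖ * β) / (1 - ‖z‖ + ‖z‖ * β) := by
    rw [h1]
    refine (norm_sub_le _ _).trans ?_
    rw [norm_one, norm_div, norm_mul, RCLike.norm_ofReal, abs_of_pos hβ0]
    calc 1 + ‖z‖ * β / ‖1 - z + z * (β : 𝕜)‖ ≤ 1 + ‖z‖ * β / (1 - ‖z‖ + ‖z‖ * β) := by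
          gcongr
      _ = _ := by field_simp; ring
  have h3 : 0 < (1 - ‖z‖ + 2 * ‖z‖ * β) / (1 - ‖z‖ + ‖z‖ * β) := by
    refine div_pos ?_ hpos
    nlinarith [mul_nonneg hnz hβ0.le]
  calc _ ≤ |ρ - β| * ((1 - ‖z‖ + 2 * ‖z‖ * β) / (1 - ‖z‖ + ‖z‖ * β)) := by gcongr
    _ < _ := by gcongr

/-- The weight of `0` in the offspring law differs from the service transform by less
than `2 ε`. -/
lemma ConditionA.abs_sub_serviceTransform_lt {lam μ ε y₀ : ℝ} {B F : Measure ℝ}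
    [IsProbabilityMeasure B] [IsProbabilityMeasure F]
    (hA : ConditionA (1 / 2) μ ε B F) (hD : ConditionD lam F y₀) (hlam : 0 < lam) (hμ : 0 < μ) :
    |(1 - min (erlangMean lam 0 (surv (residualLaw F y₀))).toReal (lam / (lam + μ)))
      - serviceTransform (1 / 2) μ lam F| < 2 * ε := by
  obtain ⟨δ, hδ0, hδε, hδ⟩ := hA.exists_bound
  have := isProbabilityMeasure_residualLaw hD.defined
  have ha := hA.abs_erlangMean_sub_le hlam hμ hδ0 hδ
  have hfin : ∀ (Q : Measure ℝ) [IsProbabilityMeasure Q], erlangMean lam 0 (surv Q) ≠ ⊤ :=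
    fun Q _ => ne_top_of_le_ne_top ENNReal.one_ne_top (erlangMean_surv_le_one hlam Q)
  have h1 : (erlangMean lam 0 (surv F)).toReal
      ≤ (erlangMean lam 0 (surv (residualLaw F y₀))).toReal + δ := by
    have := ENNReal.toReal_mono (ENNReal.add_ne_top.2 ⟨hfin _, ENNReal.ofReal_ne_top⟩)
      (erlangMean_le_add hlam fun x hx => by
        rw [abs_sub_comm]; exact hδ x y₀ hx hD.nonneg hD.defined)
    rwa [ENNReal.toReal_add (hfin _) ENNReal.ofReal_ne_top, ENNReal.toReal_ofReal hδ0] at this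
  have h2 := ENNReal.toReal_mono (hfin F) (hD.erlangMean_le hlam hA.measure_Ioi 0)
  have h3 := laplace_add_erlangMean hlam.le F hA.nonneg
  have h4 : μ / (μ + lam) = 1 - lam / (lam + μ) := by
    have : lam + μ ≠ 0 := by positivity
    rw [add_comm μ]
    field_simp
    ring
  rw [serviceTransform, h4]
  rw [abs_le] at ha
  rw [abs_lt]
  -- Let `a` and `e` be the transforms of the survival functions of `F` and of the exponential law,
  -- so that `1 - β = (a + e) / 2` and `|a - e| ≤ δ`. If the minimum is `e`, the deviation is at
  -- most `δ / 2`. If it is the value for `F_{y₀}`, which lies in `[a - δ, a]`, the deviation is at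
  -- most `3 δ / 2`.
  rcases min_choice (erlangMean lam 0 (surv (residualLaw F y₀))).toReal (lam / (lam + μ))
    with h5 | h5 <;> rw [h5] <;> constructor <;> linarith [ha.1, ha.2]

end LossQueue

/-! ### The theorem -/

open LossQueue in
theorem mainTheorem4 (lam μ ε : ℝ) (hlam : 0 < lam) (hμ : 0 < μ)
    (B F : Measure ℝ) [IsProbabilityMeasure B] [IsProbabilityMeasure F]
    (hA : ConditionA (1 / 2) μ ε B F)
    (y₀ : ℝ) (hD : ConditionD lam F y₀)
    (β : ℝ) (hβ : β = serviceTransform (1 / 2) μ lam F) :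
    ∃ q : PMF ℕ,
      (∀ z : ℝ, 0 ≤ z → z ≤ 1 →
        pgf q z < β / (1 - z + z * β)
          + 2 * ε * ((1 - z + 2 * z * β) / (1 - z + z * β))) ∧
      (∀ z : ℂ, ‖z‖ ≤ 1 →
        ‖pgf q z - (β : ℂ) / (1 - z + z * β)‖
          < 2 * ε * ((1 - ‖z‖ + 2 * ‖z‖ * β) / (1 - ‖z‖ + ‖z‖ * β))) ∧
      ∀ (n : ℕ) (G : Measure ℝ), IsProbabilityMeasure G → G (Set.Iio 0) = 0 →
        CLe lam G (residualLaw F y₀) → CLe lam G (expMeasure μ) →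
        ∀ (Ω : Type*) [MeasurableSpace Ω] (P : Measure Ω) [IsProbabilityMeasure P]
          (N : ℝ≥0 → Ω → ℕ) (χ : ℕ → Ω → ℝ), IsQueueInput lam B N χ P →
        ∀ (Ω' : Type*) [MeasurableSpace Ω'] (P' : Measure Ω') [IsProbabilityMeasure P']
          (X : ℕ → ℕ → Ω' → ℕ) (ς : ℕ → Ω' → ℕ), IsBranchingInput q lam G X ς P' →
        StochLE
          (fun ω => ((∑ i ∈ Finset.range (generationSize X n ω), ς i ω : ℕ) : ℕ∞)) P'
          (losses n N χ) P := by
  have := isProbabilityMeasure_residualLaw hD.defined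
  have hBneg : B (Set.Iio 0) = 0 := measure_mono_null Set.Iio_subset_Iic_self hA.service_pos
  have hs : 0 < lam + μ := by positivity
  have hfin : ∀ (Q : Measure ℝ) [IsProbabilityMeasure Q], erlangMean lam 0 (surv Q) ≠ ⊤ :=
    fun Q _ => ne_top_of_le_ne_top ENNReal.one_ne_top (erlangMean_surv_le_one hlam Q)
  have he1 : lam / (lam + μ) < 1 := by rw [div_lt_one hs]; linarith
  have he0 : 0 < lam / (lam + μ) := by positivity
  have ha := laplace_add_erlangMean hlam.le F hA.nonneg
  have hb := laplace_add_erlangMean hlam.le B hBneg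
  have hL0 := laplace_nonneg lam F
  have hBF : (erlangMean lam 0 (surv B)).toReal
      = 1 / 2 * (erlangMean lam 0 (surv F)).toReal + 1 / 2 * (lam / (lam + μ)) := by
    rw [hA.erlangMean_service, erlangMean_expSurv_zero hlam hμ.le, ENNReal.toReal_add
      (ENNReal.mul_ne_top (by simp) (hfin F)) (ENNReal.mul_ne_top (by simp) ENNReal.ofReal_ne_top),
      ENNReal.toReal_mul, ENNReal.toReal_mul, ENNReal.toReal_ofReal he0.le]
    simp
  have h4 : μ / (μ + lam) = 1 - lam / (lam + μ) := by
    rw [add_comm μ]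
    field_simp
    ring
  have hβB : laplace B lam = β := by
    rw [hβ, serviceTransform, h4]
    linarith
  have hβ0 : 0 < β := by
    rw [hβ, serviceTransform, h4]
    linarith
  have ha0 : 0 ≤ (erlangMean lam 0 (surv F)).toReal := ENNReal.toReal_nonneg
  have hβ1 : β ≤ 1 := by linarith
  -- The least probability, over the two components of the service law, that a residual service sees
  -- another arrival.
  set r' : ℝ≥0∞ :=
    min (erlangMean lam 0 (surv (residualLaw F y₀))) (erlangMean lam 0 (expSurv μ)) with hr'
  have hr'1 : r' ≤ 1 := (min_le_left _ _).trans (erlangMean_surv_le_one hlam _)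
  have hr : 1 - r' + r' = 1 := tsub_add_cancel_of_le hr'1
  set b : ℝ≥0∞ := ENNReal.ofReal β with hbdef
  set b' : ℝ≥0∞ := ENNReal.ofReal (1 - β) with hb'def
  have hbb : b + b' = 1 := by
    rw [hbdef, hb'def, ← ENNReal.ofReal_add hβ0.le (by linarith)]; simp
  have hb0 : b ≠ 0 := by simpa [hbdef] using hβ0
  have hg := tsum_geometric_weight hbb hb0
  have hw := tsum_offspringWeight hr hg
  let q : PMF ℕ := ⟨offspringWeight (1 - r') r' fun k => b' ^ k * b,
    ENNReal.summable.hasSum_iff.2 hw⟩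
  have hq : ∀ k, q k = offspringWeight (1 - r') r' (fun k => b' ^ k * b) k := fun k => rfl
  have hr'real : r'.toReal
      = min (erlangMean lam 0 (surv (residualLaw F y₀))).toReal (lam / (lam + μ)) := by
    rw [hr', erlangMean_expSurv_zero hlam hμ.le, ENNReal.toReal_min (hfin _) ENNReal.ofReal_ne_top,
      ENNReal.toReal_ofReal he0.le]
  set ρ : ℝ := 1 - r'.toReal with hρ
  have hρβ : |ρ - β| < 2 * ε := by
    rw [hρ, hr'real, hβ]
    exact hA.abs_sub_serviceTransform_lt hD hlam hμ
  have hq0 : (q 0).toReal = ρ := by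
    rw [hq, offspringWeight, ENNReal.toReal_sub_of_le hr'1 ENNReal.one_ne_top, ENNReal.toReal_one]
  have hqs : ∀ k, (q (k + 1)).toReal = (1 - ρ) * ((1 - β) ^ k * β) := fun k => by
    rw [hq, offspringWeight, ENNReal.toReal_mul, ENNReal.toReal_mul, ENNReal.toReal_pow,
      ENNReal.toReal_ofReal hβ0.le, ENNReal.toReal_ofReal (by linarith), hρ, sub_sub_cancel]
  refine ⟨q, fun z hz0 hz1 => ?_, fun z hz => norm_pgf_sub_lt hβ0 hβ1 hρβ hq0 hqs hz, ?_⟩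
  · have hn : ‖z‖ = z := Real.norm_of_nonneg hz0
    have h := norm_pgf_sub_lt hβ0 hβ1 hρβ hq0 hqs (z := z) (hn.trans_le hz1)
    rw [hn] at h
    have h1 := (le_abs_self _).trans_lt h
    simp only [RCLike.ofReal_real_eq_id, id_eq] at h1
    linarith
  · intro n G hGp hG0 hG1 hG2 Ω _ P _ N χ hQ Ω' _ P' _ X ς hX
    have hres := hA.residualBound hD hlam hμ hG0 hG1 hG2
    have hweights : OffspringWeights (fun k => ENNReal.ofReal (mixedPoisson lam G k)) q
        (fun k => b' ^ k * b) (1 - r') r' b b' :=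
      { summand := tsum_mixedPoisson_zero hlam.le G hG0
        offspring := hw
        geom := hg
        offspring_zero := rfl
        offspring_succ := fun _ => rfl
        geom_zero := by simp
        geom_succ := fun k => by ring
        add_eq_one := hr
        geom_add_eq_one := hbb }
    have hp0 : ENNReal.ofReal (mixedPoisson lam B 0) = b := by
      rw [mixedPoisson_zero_eq_laplace, hβB]
    have hlaw : ∀ i m, P' {ω | ς i ω = m} = ENNReal.ofReal (mixedPoisson lam G m) := fun i m => by
      rw [← hX.law_summand i m, measureReal_def, ENNReal.ofReal_toReal (measure_ne_top _ _)]
    intro m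
    cases m with
    -- The branching sum is finite, so its probability of reaching `⊤` is `0`.
    | top => simp
    | coe m =>
      have hfm : Monotone fun l : ℕ => if m ≤ l then (1 : ℝ≥0∞) else 0 := fun x y hxy => by
        dsimp only
        split_ifs <;> first | omega | simp
      calc P' {ω | (m : ℕ∞) ≤ ((∑ i ∈ Finset.range (generationSize X n ω), ς i ω : ℕ) : ℕ∞)}
          ≤ ∫⁻ ω, (if m ≤ ∑ i ∈ Finset.range (generationSize X n ω), ς i ω then 1 else 0) ∂P' := by
            have hm : MeasurableSet
                {ω | m ≤ ∑ i ∈ Finset.range (generationSize X n ω), ς i ω} :=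
              (measurable_random_sum hX.measurable_summand
                (measurable_generationSize hX.measurable_offspring n)) measurableSet_Ici
            simp only [Nat.cast_le]
            rw [← lintegral_indicator_one hm]
            exact lintegral_mono fun ω => le_of_eq (by simp [Set.indicator_apply])
        _ = genOp (fun k => ENNReal.ofReal (mixedPoisson lam G k)) q n
              (fun l => if m ≤ l then 1 else 0) 0 :=
            hX.lintegral_sum hlaw n fun l => if m ≤ l then 1 else 0
        _ ≤ levelOp (fun k => ENNReal.ofReal (mixedPoisson lam G k)) q (fun k => b' ^ k * b) n
              (fun l => if m ≤ l then 1 else 0) 0 := hres.genOp_le_levelOp hweights hp0 hfm n 0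
        _ ≤ _ := levelOp_le_measure_losses hweights hres hp0 hb0
            (fun k => hQ.measurable_arrivalsDuring k)
            (fun K m => hQ.measure_arrivalsDuring hlam.le hA.service_pos K m) n m
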